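/- Let $X=[x_1,\dots,x_p]$ be a real $n\times p$ matrix with linearly independent columns. For $y\in\mathbb R^n$ and $\lambda\ge 0$ let $\hat\beta(\lambda)=\hat\beta(\lambda;y)$ be the (unique) minimizer of $\|y-X\beta\|^2+\lambda\sum_{j}|\beta_j|$, let $\mathcal B(\lambda)=\{j:\hat\beta_j(\lambda)\neq 0\}$ be its active set, $\mathrm{Sgn}(\lambda)=(\mathrm{sgn}\,\hat\beta_j(\lambda))_j$ its sign vector, and $\hat\mu_\lambda(y)=X\hat\beta(\lambda)$ the lasso fit. The transition points are $0$ together with those $\lambda>0$ around which $\mathcal B(\cdot)$ is not locally constant. For every $y$ they form a finite sequence $\lambda_0>\lambda_1>\dots>\lambda_K=0$ (all depending on $y$); moreover $\hat\beta(\lambda)=0$ for $\lambda>\lambda_0$, and for $m<K$ the active set and the sign vector are constant on $(\lambda_{m+1},\lambda_m)$, with values denoted $\mathcal B_m$ and $\mathrm{Sgn}_m$. Let $\mathcal W_m=\mathcal B_m\setminus\mathcal B(\lambda_m)$ be the set of predictors that join the active set at $\lambda_m$ and $\mathcal V_m=\mathcal B_m\setminus\mathcal B(\lambda_{m+1})$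 the set of those that leave it at $\lambda_{m+1}$ (for $m=K$ both sets are empty by convention). For a set $B$ of predictors let $X_B$ be the submatrix of the columns in $B$ and $H_B=X_B(X_B^TX_B)^{-1}X_B^T$. For $m$ with $\lambda_m>0$ and $i\in\mathcal W_m$ write $B=\mathcal B(\lambda_m)$, $s$ for the restriction of $\mathrm{Sgn}(\lambda_m)$ to $B$, and $$d_{m,i}=(\mathrm{Sgn}_m)_i-x_i^TX_B(X_B^TX_B)^{-1}s,\qquad S_m=H_B-\frac{X_B(X_B^TX_B)^{-1}s\;x_i^T(I-H_B)}{d_{m,i}},$$ where the second term of $S_m$ is read as $0$ if $d_{m,i}=0$. Then the following hold. 1. (One at a time.) There are finitely many hyperplanes in $\mathbb R^n$, depending only on $X$, such that for every $y$ outside their union, $|\mathcal W_m|\le 1$ and $|\mathcal V_m|\le 1$ for all $m=0,\dots,K$, and $d_{m,i}\ne0$ for all $i\in\mathcal W_m$. 2. (Fit at a transition point.) For every $y$, every $m$ with $\lambda_m>0$ and every $i\in\mathcal W_m$: $\operatorname{tr}(S_m)=|\mathcal B(\lambda_m)|$, and if $d_{m,i}\neq 0$, then $\hat\mu_{\lambda_m}(y)=S_m\,y$.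 3. For $0\le k\le p$ let $\Lambda_k=\{m\le K:|\mathcal B(\lambda_m)|=k\}$ and $m_k^{\mathrm{last}}=\sup\Lambda_k$. If $y\sim N(\mu,\sigma^2I)$ with $\mu\in\mathbb R^n$ and $\sigma^2>0$, then $\Lambda_k\ne\emptyset$ almost surely. 4. (Degrees of freedom.) Suppose that the positive cone condition holds: for every set $A$ of predictors and all signs $s_j\in\{1,-1\}$, the matrix $Z=(s_jx_j)_{j\in A}$ satisfies $(Z^TZ)^{-1}\mathbf 1>0$ in every entry. Then for all $\mu\in\mathbb R^n$, $\sigma^2>0$ and $0\le k\le p$, the fit $\hat\mu_{m_k^{\mathrm{last}}}(y)=\hat\mu_{\lambda_{m_k^{\mathrm{last}}}}(y)$ at the last step with exactly $k$ nonzero predictors is square integrable under $y\sim N(\mu,\sigma^2I)$, and its degrees of freedom are $$df\big(\hat\mu_{m_k^{\mathrm{last}}}\big)=\sum_{i=1}^n\frac{\operatorname{cov}\big((\hat\mu_{m_k^{\mathrm{last}}})_i,\,y_i\big)}{\sigma^2}=k .$$ -/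

import Mathlib

open MeasureTheory ProbabilityTheory
open scoped Matrix NNReal ENNReal

noncomputable section

namespace Lasso

variable {n p : ℕ}

/-- The lasso criterion `‖y - X β‖² + l * ∑ |β_j|` (squared Euclidean norm). -/
def objective (X : Matrix (Fin n) (Fin p) ℝ) (y : Fin n → ℝ) (l : ℝ) (β : Fin p → ℝ) : ℝ :=
  ∑ i, (y i - (X *ᵥ β) i) ^ 2 + l * ∑ j, |β j|

/-- The lasso estimate, a minimizer of the criterion. When the columns of `X` are linearly
independent and `0 ≤ l` there is exactly one minimizer. -/
def coef (X : Matrix (Fin n) (Fin p) ℝ) (y : Fin n → ℝ) (l : ℝ) : Fin p → ℝ :=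
  Classical.epsilon fun β => ∀ b, objective X y l β ≤ objective X y l b

/-- The lasso fit at regularization parameter `l`. -/
def fit (X : Matrix (Fin n) (Fin p) ℝ) (y : Fin n → ℝ) (l : ℝ) : Fin n → ℝ :=
  X *ᵥ coef X y l

/-- The sign vector of the lasso estimate, with entries in `{1, 0, -1}`. -/
def sgn (X : Matrix (Fin n) (Fin p) ℝ) (y : Fin n → ℝ) (l : ℝ) (j : Fin p) : ℝ :=
  Real.sign (coef X y l j)

/-- The active set of the lasso estimate. -/
def active (X : Matrix (Fin n) (Fin p) ℝ) (y : Fin n → ℝ) (l : ℝ) : Finset (Fin p) :=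
  {j | coef X y l j ≠ 0}

/-- The transition points of the path `l ↦ coef X y l`: the positive values of `l` around which
the active set is not locally constant, together with the end point `0`. -/
def transitionPoints (X : Matrix (Fin n) (Fin p) ℝ) (y : Fin n → ℝ) : Set ℝ :=
  {l | l = 0 ∨ 0 < l ∧ ¬ ∀ᶠ l' in nhds l, active X y l' = active X y l}

/-- The index `K` of the last transition point `0`, the transition points being numbered
`knot 0 > knot 1 > ⋯ > knot K = 0`. -/
def lastIndex (X : Matrix (Fin n) (Fin p) ℝ) (y : Fin n → ℝ) : ℕ :=
  (transitionPoints X y).ncard - 1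

open Classical in
/-- The transition points in decreasing order: `knot X y m` is the one with index `m`,
for `m ≤ lastIndex X y` (and `0` for larger `m`). -/
def knot (X : Matrix (Fin n) (Fin p) ℝ) (y : Fin n → ℝ) (m : ℕ) : ℝ :=
  if h : (transitionPoints X y).Finite then
    (h.toFinset.sort (· ≥ ·)).getD m 0
  else 0

/-- The midpoint of the interval `(knot (m + 1), knot m)`. -/
def midpt (X : Matrix (Fin n) (Fin p) ℝ) (y : Fin n → ℝ) (m : ℕ) : ℝ :=
  (knot X y m + knot X y (m + 1)) / 2

/-- The active set on the open interval `(knot (m + 1), knot m)`, on which it is constant;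
it is read off at the midpoint. -/
def intervalActive (X : Matrix (Fin n) (Fin p) ℝ) (y : Fin n → ℝ) (m : ℕ) : Finset (Fin p) :=
  active X y (midpt X y m)

/-- The sign vector on the open interval `(knot (m + 1), knot m)`, on which it is constant;
it is read off at the midpoint. -/
def intervalSgn (X : Matrix (Fin n) (Fin p) ℝ) (y : Fin n → ℝ) (m : ℕ) : Fin p → ℝ :=
  sgn X y (midpt X y m)

/-- The predictors that join the active set at `knot m`: their coefficient is zero at `knot m`
and nonzero on `(knot (m + 1), knot m)`. -/
def joining (X : Matrix (Fin n) (Fin p) ℝ) (y : Fin n → ℝ) (m : ℕ) : Finset (Fin p) :=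
  intervalActive X y m \ active X y (knot X y m)

/-- The predictors that are deleted from the active set at `knot (m + 1)`: their coefficient is
nonzero on `(knot (m + 1), knot m)` and zero at `knot (m + 1)`. -/
def leaving (X : Matrix (Fin n) (Fin p) ℝ) (y : Fin n → ℝ) (m : ℕ) : Finset (Fin p) :=
  intervalActive X y m \ active X y (knot X y (m + 1))

/-- The submatrix formed by the columns of `X` with index in `A`. -/
def cols (X : Matrix (Fin n) (Fin p) ℝ) (A : Finset (Fin p)) : Matrix (Fin n) A ℝ :=
  X.submatrix id Subtype.val

/-- The orthogonal projection matrix onto the span of the columns with index in `A`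
(for linearly independent columns). -/
def hat (X : Matrix (Fin n) (Fin p) ℝ) (A : Finset (Fin p)) : Matrix (Fin n) (Fin n) ℝ :=
  cols X A * ((cols X A)ᵀ * cols X A)⁻¹ * (cols X A)ᵀ

/-- The vector `X_B (X_Bᵀ X_B)⁻¹ s_B`, with `B` and `s` the active set and the sign vector
at `knot m`. -/
def stepDir (X : Matrix (Fin n) (Fin p) ℝ) (y : Fin n → ℝ) (m : ℕ) : Fin n → ℝ :=
  cols X (active X y (knot X y m)) *ᵥ
    (((cols X (active X y (knot X y m)))ᵀ * cols X (active X y (knot X y m)))⁻¹ *ᵥ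
      fun j => sgn X y (knot X y m) j)

/-- The scalar `Sgn_i - x_iᵀ X_B (X_Bᵀ X_B)⁻¹ s_B`, where `Sgn_i` is the sign with which the
predictor `i` joins the active set at `knot m`. -/
def stepDenom (X : Matrix (Fin n) (Fin p) ℝ) (y : Fin n → ℝ) (m : ℕ) (i : Fin p) : ℝ :=
  intervalSgn X y m i - X.col i ⬝ᵥ stepDir X y m

/-- The matrix
`S_m = H_B - X_B (X_Bᵀ X_B)⁻¹ s_B x_iᵀ (I - H_B) / (Sgn_i - x_iᵀ X_B (X_Bᵀ X_B)⁻¹ s_B)`. -/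
def stepMatrix (X : Matrix (Fin n) (Fin p) ℝ) (y : Fin n → ℝ) (m : ℕ) (i : Fin p) :
    Matrix (Fin n) (Fin n) ℝ :=
  hat X (active X y (knot X y m)) -
    (1 / stepDenom X y m i) •
      Matrix.vecMulVec (stepDir X y m) (X.col i ᵥ* (1 - hat X (active X y (knot X y m))))

/-- The steps `m` at which the fit has exactly `k` nonzero coefficients. -/
def stepsWith (X : Matrix (Fin n) (Fin p) ℝ) (y : Fin n → ℝ) (k : ℕ) : Set ℕ :=
  {m | m ≤ lastIndex X y ∧ (active X y (knot X y m)).card = k}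

/-- The last step at which the fit has exactly `k` nonzero coefficients. -/
def lastStep (X : Matrix (Fin n) (Fin p) ℝ) (y : Fin n → ℝ) (k : ℕ) : ℕ :=
  sSup (stepsWith X y k)

/-- The lasso fit at the last step with exactly `k` nonzero coefficients. -/
def lastFit (X : Matrix (Fin n) (Fin p) ℝ) (k : ℕ) (y : Fin n → ℝ) : Fin n → ℝ :=
  fit X y (knot X y (lastStep X y k))

/-- The positive cone condition: for every set `A` of predictors and every choice of signs,
the matrix `Z` with columns `s_j x_j`, `j ∈ A`, satisfies `(Zᵀ Z)⁻¹ 1 > 0` entrywise. -/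
def PositiveCone (X : Matrix (Fin n) (Fin p) ℝ) : Prop :=
  ∀ (A : Finset (Fin p)) (s : Fin p → ℝ), (∀ j, s j = 1 ∨ s j = -1) →
    ∀ i : A,
      0 < (((cols (X * Matrix.diagonal s) A)ᵀ * cols (X * Matrix.diagonal s) A)⁻¹ *ᵥ 1) i

/-- The law `N(μ, v I)` on `ℝⁿ`. -/
def normalLaw (μ : Fin n → ℝ) (v : ℝ≥0) : Measure (Fin n → ℝ) :=
  Measure.pi fun i => gaussianReal (μ i) v

/-- The degrees of freedom `∑ cov(δ_i(y), y_i) / v` of a fitting procedure `δ`,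
where `y ∼ N(μ, v I)`. -/
def df (μ : Fin n → ℝ) (v : ℝ≥0) (δ : (Fin n → ℝ) → Fin n → ℝ) : ℝ :=
  ∑ i, cov[fun y => δ y i, fun y => y i; normalLaw μ v] / (v : ℝ)

end Lasso

end

noncomputable section

namespace Lasso

variable {n p : ℕ}

/-- The gradient `2 Xᵀ (y - X β)` of the negative residual sum of squares. -/
def score (X : Matrix (Fin n) (Fin p) ℝ) (y : Fin n → ℝ) (β : Fin p → ℝ) : Fin p → ℝ :=
  (2 : ℝ) • (Xᵀ *ᵥ (y - X *ᵥ β))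

/-- The optimality conditions for the lasso criterion. -/
def KKT (X : Matrix (Fin n) (Fin p) ℝ) (y : Fin n → ℝ) (l : ℝ) (β : Fin p → ℝ) : Prop :=
  ∀ j, |score X y β j| ≤ l ∧ score X y β j * β j = l * |β j|

theorem objective_eq (X : Matrix (Fin n) (Fin p) ℝ) (y : Fin n → ℝ) (l : ℝ) (β b : Fin p → ℝ) :
    objective X y l b = objective X y l β + (X *ᵥ (b - β)) ⬝ᵥ (X *ᵥ (b - β))
      + ∑ j, (l * |b j| - l * |β j| - score X y β j * (b j - β j)) := by
  have h : ∑ j, score X y β j * (b j - β j) = 2 * ((y - X *ᵥ β) ⬝ᵥ (X *ᵥ (b - β))) := by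
    rw [Matrix.dotProduct_mulVec, ← Matrix.mulVec_transpose, score]
    simp [dotProduct, Finset.mul_sum, mul_assoc]
  rw [Finset.sum_sub_distrib, Finset.sum_sub_distrib, h, objective, objective, ← Finset.mul_sum,
    ← Finset.mul_sum]
  have h2 : ∑ i, (y i - (X *ᵥ b) i) ^ 2 = ∑ i, (y i - (X *ᵥ β) i) ^ 2
      + (X *ᵥ (b - β)) ⬝ᵥ (X *ᵥ (b - β)) - 2 * ((y - X *ᵥ β) ⬝ᵥ (X *ᵥ (b - β))) := by
    simp only [dotProduct, Finset.mul_sum, ← Finset.sum_add_distrib, ← Finset.sum_sub_distrib,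
      Matrix.mulVec_sub, Pi.sub_apply]
    exact Finset.sum_congr rfl fun i _ => by ring
  rw [h2]; ring

theorem KKT.objective_le {X : Matrix (Fin n) (Fin p) ℝ} {y : Fin n → ℝ} {l : ℝ} {β : Fin p → ℝ}
    (h : KKT X y l β) (b : Fin p → ℝ) :
    objective X y l β + (X *ᵥ (b - β)) ⬝ᵥ (X *ᵥ (b - β)) ≤ objective X y l b := by
  rw [objective_eq X y l β b]
  refine le_add_of_nonneg_right (Finset.sum_nonneg fun j _ => ?_)
  have h1 := (h j).1
  have h2 := (h j).2
  have h3 : score X y β j * b j ≤ l * |b j| :=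
    (le_abs_self _).trans (by rw [abs_mul]; gcongr)
  nlinarith

theorem KKT.of_minimizer {X : Matrix (Fin n) (Fin p) ℝ} {y : Fin n → ℝ} {l : ℝ} {β : Fin p → ℝ}
    (hl : 0 ≤ l) (h : ∀ b, objective X y l β ≤ objective X y l b) : KKT X y l β := by
  intro j
  set c := score X y β j with hc
  set q := (X *ᵥ Pi.single j 1) ⬝ᵥ (X *ᵥ Pi.single j 1) with hq
  have hq0 : 0 ≤ q := by
    rw [hq, dotProduct]; exact Finset.sum_nonneg fun i _ => mul_self_nonneg _
  have key : ∀ t : ℝ, c * t ≤ t ^ 2 * q + l * |β j + t| - l * |β j| := by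
    intro t
    have h1 := h (β + t • Pi.single j 1)
    rw [objective_eq X y l β (β + t • Pi.single j 1), add_sub_cancel_left,
      Matrix.mulVec_smul, dotProduct_smul, smul_dotProduct, Finset.sum_eq_single j] at h1
    · simp only [Pi.add_apply, Pi.smul_apply, Pi.single_eq_same, smul_eq_mul, mul_one] at h1
      rw [← hq, ← hc] at h1
      nlinarith
    · intro i _ hi; simp [hi]
    · simp
  have hle : |c| ≤ l := by
    by_contra! hcl
    have h2 : ∀ t : ℝ, c * t ≤ t ^ 2 * q + l * |t| := fun t => by
      have := key t
      have h3 : |β j + t| ≤ |β j| + |t| := abs_add_le _ _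
      nlinarith
    have h4 : ∀ e : ℝ, 0 < e → |c| - l ≤ e * q := by
      intro e he
      rcases abs_cases c with ⟨h5, -⟩ | ⟨h5, -⟩
      · have := h2 e
        rw [abs_of_pos he] at this
        rw [h5]; by_contra! h6; nlinarith
      · have := h2 (-e)
        rw [abs_neg, abs_of_pos he] at this
        rw [h5]; by_contra! h6; nlinarith
    have h5 := h4 ((|c| - l) / (2 * (q + 1))) (by have := sub_pos.2 hcl; positivity)
    rw [div_mul_eq_mul_div, le_div_iff₀ (by positivity)] at h5
    nlinarith [sub_pos.2 hcl]
  refine ⟨hle, le_antisymm ((le_abs_self _).trans (by rw [abs_mul]; gcongr)) ?_⟩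
  by_contra! h6
  have h4 : ∀ e : ℝ, 0 < e → e ≤ 1 → l * |β j| - c * β j ≤ e * (β j ^ 2 * q) := by
    intro e he he1
    have := key (-e * β j)
    have h7 : |β j + -e * β j| = (1 - e) * |β j| := by
      rw [show β j + -e * β j = (1 - e) * β j by ring, abs_mul, abs_of_nonneg (by linarith)]
    rw [h7] at this
    by_contra! h8; nlinarith
  set D := l * |β j| - c * β j with hD
  have hD0 : 0 < D := sub_pos.2 h6
  have hQ : 0 ≤ β j ^ 2 * q := by positivity
  have h5 := h4 (D / (2 * (β j ^ 2 * q + D))) (by positivity)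
    (by rw [div_le_one (by positivity)]; linarith)
  rw [div_mul_eq_mul_div, le_div_iff₀ (by positivity)] at h5
  nlinarith

theorem sq_norm_le_dotProduct (u : Fin n → ℝ) : ‖u‖ ^ 2 ≤ u ⬝ᵥ u := by
  have h0 : 0 ≤ u ⬝ᵥ u := Finset.sum_nonneg fun i _ => mul_self_nonneg _
  rw [← Real.le_sqrt (norm_nonneg _) h0, pi_norm_le_iff_of_nonneg (Real.sqrt_nonneg _)]
  intro i
  rw [Real.norm_eq_abs]
  apply Real.abs_le_sqrt
  rw [sq]
  exact Finset.single_le_sum (f := fun i => u i * u i) (fun i _ => mul_self_nonneg _)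
    (Finset.mem_univ i)

theorem exists_sq_norm_le (X : Matrix (Fin n) (Fin p) ℝ) (hX : LinearIndependent ℝ X.col) :
    ∃ C : ℝ, 0 < C ∧ ∀ b : Fin p → ℝ, ‖b‖ ^ 2 ≤ C * ((X *ᵥ b) ⬝ᵥ (X *ᵥ b)) := by
  obtain ⟨K, hK, h⟩ := X.mulVecLin.exists_antilipschitzWith
    (LinearMap.ker_eq_bot.2 (Matrix.mulVec_injective_iff.2 hX))
  refine ⟨(K : ℝ) ^ 2, by positivity, fun b => ?_⟩
  have h1 : ‖b‖ ≤ K * ‖X *ᵥ b‖ := by simpa using h.le_mul_norm_sub b 0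
  calc ‖b‖ ^ 2 ≤ (K * ‖X *ᵥ b‖) ^ 2 := by gcongr
    _ = K ^ 2 * ‖X *ᵥ b‖ ^ 2 := by ring
    _ ≤ _ := by gcongr; exact sq_norm_le_dotProduct _

theorem exists_minimizer (X : Matrix (Fin n) (Fin p) ℝ) (hX : LinearIndependent ℝ X.col)
    (y : Fin n → ℝ) {l : ℝ} (hl : 0 ≤ l) :
    ∃ β, ∀ b, objective X y l β ≤ objective X y l b := by
  have hc : Continuous (objective X y l) := by
    unfold objective
    simp only [Matrix.mulVec, dotProduct]
    fun_prop
  refine hc.exists_forall_le' 0 ?_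
  obtain ⟨C, hC, h⟩ := exists_sq_norm_le X hX
  have h1 : Filter.Tendsto (fun b : Fin p → ℝ => ‖b‖) (Filter.cocompact _) Filter.atTop :=
    tendsto_norm_cocompact_atTop
  have h2 : Filter.Tendsto (fun b : Fin p → ℝ => ‖b‖ ^ 2) (Filter.cocompact _) Filter.atTop :=
    (Filter.tendsto_pow_atTop two_ne_zero).comp h1
  filter_upwards [h2.eventually_ge_atTop (C * (4 * (y ⬝ᵥ y)))] with b hb
  have h3 : 4 * (y ⬝ᵥ y) ≤ (X *ᵥ b) ⬝ᵥ (X *ᵥ b) := le_of_mul_le_mul_left (hb.trans (h b)) hC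
  have h4 : objective X y l 0 = y ⬝ᵥ y := by simp [objective, dotProduct, sq]
  have h5 : (X *ᵥ b) ⬝ᵥ (X *ᵥ b) ≤ 2 * ∑ i, (y i - (X *ᵥ b) i) ^ 2 + 2 * (y ⬝ᵥ y) := by
    simp only [dotProduct, Finset.mul_sum, ← Finset.sum_add_distrib]
    exact Finset.sum_le_sum fun i _ => by nlinarith [sq_nonneg (2 * y i - (X *ᵥ b) i)]
  have h6 : 0 ≤ l * ∑ j, |b j| := mul_nonneg hl (Finset.sum_nonneg fun j _ => abs_nonneg _)
  rw [h4, objective]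
  linarith

theorem KKT.eq_of_minimizer {X : Matrix (Fin n) (Fin p) ℝ} (hX : LinearIndependent ℝ X.col)
    {y : Fin n → ℝ} {l : ℝ} {β b : Fin p → ℝ} (h : KKT X y l β)
    (hb : ∀ b', objective X y l b ≤ objective X y l b') : b = β := by
  obtain ⟨C, hC, hn⟩ := exists_sq_norm_le X hX
  have h1 := h.objective_le b
  have h2 := hb β
  have h3 : (X *ᵥ (b - β)) ⬝ᵥ (X *ᵥ (b - β)) ≤ 0 := by linarith
  have h4 : ‖b - β‖ ^ 2 ≤ 0 := (hn _).trans (by nlinarith)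
  have h5 : ‖b - β‖ = 0 := by nlinarith [norm_nonneg (b - β)]
  exact sub_eq_zero.1 (norm_eq_zero.1 h5)

theorem existsUnique_minimizer (X : Matrix (Fin n) (Fin p) ℝ) (hX : LinearIndependent ℝ X.col)
    (y : Fin n → ℝ) {l : ℝ} (hl : 0 ≤ l) :
    ∃! β, ∀ b, objective X y l β ≤ objective X y l b := by
  obtain ⟨β, hβ⟩ := exists_minimizer X hX y hl
  exact ⟨β, hβ, fun b hb => (KKT.of_minimizer hl hβ).eq_of_minimizer hX hb⟩

theorem kkt_coef {X : Matrix (Fin n) (Fin p) ℝ} (hX : LinearIndependent ℝ X.col)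
    (y : Fin n → ℝ) {l : ℝ} (hl : 0 ≤ l) : KKT X y l (coef X y l) :=
  KKT.of_minimizer hl (Classical.epsilon_spec (exists_minimizer X hX y hl))

theorem KKT.coef_eq {X : Matrix (Fin n) (Fin p) ℝ} (hX : LinearIndependent ℝ X.col)
    {y : Fin n → ℝ} {l : ℝ} (hl : 0 ≤ l) {β : Fin p → ℝ} (h : KKT X y l β) : coef X y l = β :=
  h.eq_of_minimizer hX (Classical.epsilon_spec (exists_minimizer X hX y hl))

theorem KKT.dotProduct_le {X : Matrix (Fin n) (Fin p) ℝ} {y y' : Fin n → ℝ} {l l' : ℝ}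
    {β β' : Fin p → ℝ} (h : KKT X y l β) (h' : KKT X y' l' β') :
    2 * ((X *ᵥ (β - β')) ⬝ᵥ (X *ᵥ (β - β'))) ≤
      2 * ((y - y') ⬝ᵥ (X *ᵥ (β - β'))) - (l - l') * ∑ j, (|β j| - |β' j|) := by
  have h1 : ∑ j, (score X y β j - score X y' β' j) * (β j - β' j) =
      2 * ((y - y') ⬝ᵥ (X *ᵥ (β - β'))) - 2 * ((X *ᵥ (β - β')) ⬝ᵥ (X *ᵥ (β - β'))) := by
    have : (fun j => score X y β j - score X y' β' j) =
        (2 : ℝ) • ((y - y' - X *ᵥ (β - β')) ᵥ* X) := by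
      have e : y - y' - X *ᵥ (β - β') = (y - X *ᵥ β) - (y' - X *ᵥ β') := by
        rw [Matrix.mulVec_sub]; abel
      change score X y β - score X y' β' = _
      rw [← Matrix.mulVec_transpose, score, score, ← smul_sub, e, ← Matrix.mulVec_sub]
    calc _ = (fun j => score X y β j - score X y' β' j) ⬝ᵥ (β - β') := rfl
      _ = _ := by
        rw [this, smul_dotProduct, ← Matrix.dotProduct_mulVec, sub_dotProduct, smul_eq_mul]
        ring
  have h2 : (l - l') * ∑ j, (|β j| - |β' j|) ≤
      ∑ j, (score X y β j - score X y' β' j) * (β j - β' j) := by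
    rw [Finset.mul_sum]
    refine Finset.sum_le_sum fun j _ => ?_
    have a1 := (h j).2
    have a2 := (h' j).2
    have a3 : score X y β j * β' j ≤ l * |β' j| :=
      (le_abs_self _).trans (by rw [abs_mul]; gcongr; exact (h j).1)
    have a4 : score X y' β' j * β j ≤ l' * |β j| :=
      (le_abs_self _).trans (by rw [abs_mul]; gcongr; exact (h' j).1)
    nlinarith
  linarith

theorem exists_norm_coef_sub_le (X : Matrix (Fin n) (Fin p) ℝ) (hX : LinearIndependent ℝ X.col) :
    ∃ C : ℝ, 0 ≤ C ∧ ∀ (y y' : Fin n → ℝ) (l l' : ℝ), 0 ≤ l → 0 ≤ l' →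
      ‖coef X y l - coef X y' l'‖ ≤ C * (‖y - y'‖ + |l - l'|) := by
  obtain ⟨C, hC, hn⟩ := exists_sq_norm_le X hX
  set M : ℝ := ‖LinearMap.toContinuousLinearMap X.mulVecLin‖ with hM
  have hM0 : 0 ≤ M := norm_nonneg _
  refine ⟨C * (n * M + p), by positivity, fun y y' l l' hl hl' => ?_⟩
  have h1 := (kkt_coef hX y hl).dotProduct_le (kkt_coef hX y' hl')
  set β := coef X y l
  set β' := coef X y' l'
  have h2 := hn (β - β')
  have h3 : (y - y') ⬝ᵥ (X *ᵥ (β - β')) ≤ n * (‖y - y'‖ * (M * ‖β - β'‖)) := by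
    calc (y - y') ⬝ᵥ (X *ᵥ (β - β')) ≤ ∑ _i : Fin n, ‖y - y'‖ * (M * ‖β - β'‖) := by
          refine Finset.sum_le_sum fun i _ => (le_abs_self _).trans ?_
          rw [abs_mul]
          gcongr
          · exact norm_le_pi_norm (y - y') i
          · exact (norm_le_pi_norm (X *ᵥ (β - β')) i).trans
              ((LinearMap.toContinuousLinearMap X.mulVecLin).le_opNorm (β - β'))
      _ = _ := by simp
  have h4 : -((l - l') * ∑ j, (|β j| - |β' j|)) ≤ |l - l'| * (p * ‖β - β'‖) := by
    refine (neg_le_abs _).trans ?_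
    rw [abs_mul]
    gcongr
    refine (Finset.abs_sum_le_sum_abs _ _).trans ?_
    calc ∑ j, |(|β j| - |β' j|)| ≤ ∑ _j : Fin p, ‖β - β'‖ :=
          Finset.sum_le_sum fun j _ =>
            (abs_abs_sub_abs_le _ _).trans (norm_le_pi_norm (β - β') j)
      _ = _ := by simp
  rcases (norm_nonneg (β - β')).eq_or_lt with h0 | h0
  · rw [← h0]; positivity
  · refine le_of_mul_le_mul_right ?_ h0
    have h5 : (X *ᵥ (β - β')) ⬝ᵥ (X *ᵥ (β - β')) ≤
        (n * M * ‖y - y'‖ + p * |l - l'|) * ‖β - β'‖ := by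
      have : 0 ≤ |l - l'| * (p * ‖β - β'‖) := by positivity
      nlinarith
    have h6 : n * M * ‖y - y'‖ + p * |l - l'| ≤ (n * M + p) * (‖y - y'‖ + |l - l'|) := by
      have a1 : 0 ≤ n * M * |l - l'| := by positivity
      have a2 : 0 ≤ p * ‖y - y'‖ := by positivity
      nlinarith
    calc ‖β - β'‖ * ‖β - β'‖ = ‖β - β'‖ ^ 2 := (sq _).symm
      _ ≤ C * ((n * M * ‖y - y'‖ + p * |l - l'|) * ‖β - β'‖) := h2.trans (by gcongr)
      _ ≤ C * (((n * M + p) * (‖y - y'‖ + |l - l'|)) * ‖β - β'‖) := by gcongr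
      _ = _ := by ring

theorem continuous_coef_max {X : Matrix (Fin n) (Fin p) ℝ} (hX : LinearIndependent ℝ X.col) :
    Continuous fun q : (Fin n → ℝ) × ℝ => coef X q.1 (max q.2 0) := by
  obtain ⟨C, hC, h⟩ := exists_norm_coef_sub_le X hX
  refine LipschitzWith.continuous (K := (C * 2).toNNReal) (LipschitzWith.of_dist_le_mul ?_)
  rintro ⟨y, l⟩ ⟨y', l'⟩
  rw [dist_eq_norm]
  refine (h _ _ _ _ (le_max_right _ _) (le_max_right _ _)).trans ?_
  rw [Real.coe_toNNReal _ (by positivity), mul_assoc]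
  gcongr
  have h1 : |max l 0 - max l' 0| ≤ |l - l'| := by
    simpa using abs_max_sub_max_le_abs l l' 0
  have h2 : dist y y' ≤ dist (y, l) (y', l') := by rw [Prod.dist_eq]; exact le_max_left _ _
  have h3 : dist l l' ≤ dist (y, l) (y', l') := by rw [Prod.dist_eq]; exact le_max_right _ _
  rw [dist_eq_norm] at h2
  rw [Real.dist_eq] at h3
  linarith

/-- Twice the correlation of the predictors with the current residual. -/
def corr (X : Matrix (Fin n) (Fin p) ℝ) (y : Fin n → ℝ) (l : ℝ) : Fin p → ℝ :=
  score X y (coef X y l)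

@[simp]
theorem mem_active {X : Matrix (Fin n) (Fin p) ℝ} {y : Fin n → ℝ} {l : ℝ} {j : Fin p} :
    j ∈ active X y l ↔ coef X y l j ≠ 0 := by
  simp [active]

theorem sign_mul_abs (r : ℝ) : Real.sign r * |r| = r := by
  rcases lt_trichotomy r 0 with h | h | h
  · rw [Real.sign_of_neg h, abs_of_neg h]; ring
  · simp [h]
  · rw [Real.sign_of_pos h, abs_of_pos h]; ring

theorem sign_mul_self (r : ℝ) : Real.sign r * r = |r| := by
  rcases lt_trichotomy r 0 with h | h | h
  · rw [Real.sign_of_neg h, abs_of_neg h]; ring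
  · simp [h]
  · rw [Real.sign_of_pos h, abs_of_pos h]; ring

theorem sgn_eq_zero_iff {X : Matrix (Fin n) (Fin p) ℝ} {y : Fin n → ℝ} {l : ℝ} {j : Fin p} :
    sgn X y l j = 0 ↔ coef X y l j = 0 := by
  rw [sgn, Real.sign_eq_zero_iff]

theorem abs_corr_le {X : Matrix (Fin n) (Fin p) ℝ} (hX : LinearIndependent ℝ X.col)
    (y : Fin n → ℝ) {l : ℝ} (hl : 0 ≤ l) (j : Fin p) : |corr X y l j| ≤ l :=
  (kkt_coef hX y hl j).1

theorem corr_of_mem_active {X : Matrix (Fin n) (Fin p) ℝ} (hX : LinearIndependent ℝ X.col)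
    (y : Fin n → ℝ) {l : ℝ} (hl : 0 ≤ l) {j : Fin p} (hj : j ∈ active X y l) :
    corr X y l j = l * sgn X y l j := by
  have h := (kkt_coef hX y hl j).2
  have h0 := mem_active.1 hj
  rw [← sign_mul_self, ← mul_assoc] at h
  exact mul_right_cancel₀ h0 h

theorem abs_corr_of_mem_active {X : Matrix (Fin n) (Fin p) ℝ} (hX : LinearIndependent ℝ X.col)
    (y : Fin n → ℝ) {l : ℝ} (hl : 0 ≤ l) {j : Fin p} (hj : j ∈ active X y l) :
    |corr X y l j| = l := by
  rw [corr_of_mem_active hX y hl hj, abs_mul, abs_of_nonneg hl, sgn]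
  rcases Real.sign_apply_eq_of_ne_zero _ (mem_active.1 hj) with h | h <;> simp [h]

theorem active_congr {X : Matrix (Fin n) (Fin p) ℝ} {y : Fin n → ℝ} {l l' : ℝ}
    (h : sgn X y l = sgn X y l') : active X y l = active X y l' := by
  ext j
  rw [mem_active, mem_active, ← not_iff_not, not_not, not_not, ← sgn_eq_zero_iff,
    ← sgn_eq_zero_iff, h]

theorem score_combo (X : Matrix (Fin n) (Fin p) ℝ) (y : Fin n → ℝ) (β b : Fin p → ℝ) (t : ℝ) :
    score X y ((1 - t) • β + t • b) = (1 - t) • score X y β + t • score X y b := by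
  have : y - X *ᵥ ((1 - t) • β + t • b) = (1 - t) • (y - X *ᵥ β) + t • (y - X *ᵥ b) := by
    rw [Matrix.mulVec_add, Matrix.mulVec_smul, Matrix.mulVec_smul]
    module
  rw [score, this, Matrix.mulVec_add, Matrix.mulVec_smul, Matrix.mulVec_smul, score, score]
  module

theorem sgn_eq_of_mem_Icc {X : Matrix (Fin n) (Fin p) ℝ} (hX : LinearIndependent ℝ X.col)
    {y : Fin n → ℝ} {a b l : ℝ} (ha : 0 ≤ a) (hl : l ∈ Set.Icc a b)
    (h : sgn X y a = sgn X y b) : sgn X y l = sgn X y a := by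
  rcases (hl.1.trans hl.2).eq_or_lt with hab | hab
  · rw [show l = a from le_antisymm (hab ▸ hl.2) hl.1]
  obtain ⟨t, ht0, ht1, rfl⟩ : ∃ t, 0 ≤ t ∧ t ≤ 1 ∧ l = (1 - t) * a + t * b := by
    refine ⟨(l - a) / (b - a), div_nonneg (sub_nonneg.2 hl.1) (sub_nonneg.2 hab.le),
      (div_le_one (sub_pos.2 hab)).2 (by linarith [hl.2]), ?_⟩
    field_simp [(sub_pos.2 hab).ne']
    ring
  have hb : 0 ≤ b := ha.trans hab.le
  set β := (1 - t) • coef X y a + t • coef X y b with hβ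
  have h1t : 0 ≤ 1 - t := sub_nonneg.2 ht1
  have hs : ∀ j, Real.sign (coef X y b j) = Real.sign (coef X y a j) := fun j =>
    (congrFun h j).symm
  have hβj : ∀ j, β j =
      Real.sign (coef X y a j) * ((1 - t) * |coef X y a j| + t * |coef X y b j|) := by
    intro j
    have h1 := sign_mul_abs (coef X y a j)
    have h2 := sign_mul_abs (coef X y b j)
    rw [hs j] at h2
    simp only [hβ, Pi.add_apply, Pi.smul_apply, smul_eq_mul]
    linear_combination -(1 - t) * h1 - t * h2
  have hsj : ∀ j, Real.sign (β j) = Real.sign (coef X y a j) := by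
    intro j
    rw [hβj j]
    rcases lt_trichotomy (coef X y a j) 0 with h0 | h0 | h0
    · have h1 : coef X y b j ≠ 0 := fun h3 => by
        have := hs j
        rw [h3, Real.sign_of_neg h0, Real.sign_zero] at this
        norm_num at this
      have : 0 < (1 - t) * |coef X y a j| + t * |coef X y b j| := by
        have a1 := abs_pos.2 h0.ne
        have a2 := abs_pos.2 h1
        rcases ht0.eq_or_lt with h5 | h5
        · rw [← h5]; simpa using h0.ne
        · exact add_pos_of_nonneg_of_pos (by positivity) (by positivity)
      rw [Real.sign_of_neg h0, Real.sign_of_neg (by linarith)]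
    · simp [h0]
    · have h1 : coef X y b j ≠ 0 := fun h3 => by
        have := hs j
        rw [h3, Real.sign_of_pos h0, Real.sign_zero] at this
        norm_num at this
      have : 0 < (1 - t) * |coef X y a j| + t * |coef X y b j| := by
        have a1 := abs_pos.2 h0.ne'
        have a2 := abs_pos.2 h1
        rcases ht0.eq_or_lt with h5 | h5
        · rw [← h5]; simpa using h0.ne'
        · exact add_pos_of_nonneg_of_pos (by positivity) (by positivity)
      rw [Real.sign_of_pos h0, one_mul, Real.sign_of_pos this]
  have hk : KKT X y ((1 - t) * a + t * b) β := by
    intro j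
    have h1 := kkt_coef hX y ha j
    have h2 := kkt_coef hX y hb j
    have hsc : score X y β j =
        (1 - t) * score X y (coef X y a) j + t * score X y (coef X y b) j := by
      rw [hβ, score_combo]; rfl
    constructor
    · rw [hsc]
      refine (abs_add_le _ _).trans ?_
      rw [abs_mul, abs_mul, abs_of_nonneg h1t, abs_of_nonneg ht0]
      gcongr
      exacts [h1.1, h2.1]
    · rw [← sign_mul_self (β j), hsj j, ← mul_assoc]
      by_cases h0 : coef X y a j = 0
      · have : β j = 0 := by rw [hβj j, h0]; simp
        rw [this]; simp
      congr 1
      have h0' : coef X y b j ≠ 0 := fun h3 => by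
        have := hs j
        rw [h3, Real.sign_zero, eq_comm, Real.sign_eq_zero_iff] at this
        exact h0 this
      have e1 := corr_of_mem_active hX y ha (mem_active.2 h0)
      have e2 := corr_of_mem_active hX y hb (mem_active.2 h0')
      rw [← h] at e2
      simp only [corr, sgn] at e1 e2
      rw [hsc, e1, e2]
      ring
  ext j
  rw [sgn, hk.coef_eq hX (by positivity), hsj j, sgn]

theorem finite_transitionPoints {X : Matrix (Fin n) (Fin p) ℝ} (hX : LinearIndependent ℝ X.col)
    (y : Fin n → ℝ) : (transitionPoints X y).Finite := by
  have hT : {s : Fin p → ℝ | ∀ j, s j ∈ ({-1, 0, 1} : Set ℝ)}.Finite :=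
    Set.Finite.pi' fun _ => Set.toFinite _
  set T := {s : Fin p → ℝ | ∀ j, s j ∈ ({-1, 0, 1} : Set ℝ)}
  let I : (Fin p → ℝ) → Set ℝ := fun s => {t | 0 ≤ t ∧ sgn X y t = s}
  refine (((Set.finite_singleton (0 : ℝ)).union (hT.image fun s => sSup (I s))).union
    (hT.image fun s => sInf (I s))).subset ?_
  rintro l (rfl | ⟨hl, h⟩)
  · exact Or.inl (Or.inl rfl)
  have hs : sgn X y l ∈ T := fun j => by
    rcases Real.sign_apply_eq (coef X y l j) with h | h | h <;> simp [sgn, h]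
  have hmem : l ∈ I (sgn X y l) := ⟨hl.le, rfl⟩
  by_cases h1 : ∀ t ∈ I (sgn X y l), t ≤ l
  · exact Or.inl (Or.inr ⟨_, hs, IsGreatest.csSup_eq ⟨hmem, h1⟩⟩)
  by_cases h2 : ∀ t ∈ I (sgn X y l), l ≤ t
  · exact Or.inr ⟨_, hs, IsLeast.csInf_eq ⟨hmem, h2⟩⟩
  push Not at h1 h2
  obtain ⟨b, hb, hlb⟩ := h1
  obtain ⟨a, ha, hal⟩ := h2
  refine absurd ?_ h
  filter_upwards [Ioo_mem_nhds hal hlb] with l' hl'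
  refine active_congr ?_
  rw [sgn_eq_of_mem_Icc hX ha.1 ⟨hl'.1.le, hl'.2.le⟩ (ha.2.trans hb.2.symm), ha.2]

theorem continuousOn_coef {X : Matrix (Fin n) (Fin p) ℝ} (hX : LinearIndependent ℝ X.col)
    (y : Fin n → ℝ) : ContinuousOn (coef X y) (Set.Ici 0) := by
  have h : Continuous fun l : ℝ => coef X y (max l 0) :=
    (continuous_coef_max hX).comp (f := fun l : ℝ => (y, l))
      (continuous_const.prodMk continuous_id)
  exact h.continuousOn.congr fun l hl => by simp [max_eq_left (Set.mem_Ici.1 hl)]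

theorem continuousAt_coef {X : Matrix (Fin n) (Fin p) ℝ} (hX : LinearIndependent ℝ X.col)
    (y : Fin n → ℝ) {l : ℝ} (hl : 0 < l) : ContinuousAt (coef X y) l :=
  (continuousOn_coef hX y).continuousAt (Ici_mem_nhds hl)

theorem continuous_score (X : Matrix (Fin n) (Fin p) ℝ) :
    Continuous fun q : (Fin n → ℝ) × (Fin p → ℝ) => score X q.1 q.2 := by
  have h : Continuous fun q : (Fin n → ℝ) × (Fin p → ℝ) => Xᵀ *ᵥ (q.1 - X *ᵥ q.2) :=
    continuous_const.matrix_mulVec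
      (continuous_fst.sub (continuous_const.matrix_mulVec continuous_snd))
  exact h.const_smul (2 : ℝ)

theorem continuousOn_corr {X : Matrix (Fin n) (Fin p) ℝ} (hX : LinearIndependent ℝ X.col)
    (y : Fin n → ℝ) : ContinuousOn (corr X y) (Set.Ici 0) :=
  (continuous_score X).comp_continuousOn
    (f := fun l => (y, coef X y l)) (continuousOn_const.prodMk (continuousOn_coef hX y))

theorem continuousAt_corr {X : Matrix (Fin n) (Fin p) ℝ} (hX : LinearIndependent ℝ X.col)
    (y : Fin n → ℝ) {l : ℝ} (hl : 0 < l) : ContinuousAt (corr X y) l :=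
  (continuousOn_corr hX y).continuousAt (Ici_mem_nhds hl)

theorem eventually_sgn_eq {X : Matrix (Fin n) (Fin p) ℝ} (hX : LinearIndependent ℝ X.col)
    {y : Fin n → ℝ} {l : ℝ} (hl : 0 < l) (h : l ∉ transitionPoints X y) :
    ∀ᶠ l' in nhds l, sgn X y l' = sgn X y l := by
  have hloc : ∀ᶠ l' in nhds l, active X y l' = active X y l := by
    by_contra h'; exact h (Or.inr ⟨hl, h'⟩)
  have hj : ∀ᶠ l' in nhds l, ∀ j, coef X y l j ≠ 0 → 0 < coef X y l' j * coef X y l j := by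
    rw [Filter.eventually_all]
    intro j
    by_cases h0 : coef X y l j = 0
    · simp [h0]
    · have hc : ContinuousAt (fun l' => coef X y l' j * coef X y l j) l :=
        ((continuousAt_pi.1 (continuousAt_coef hX y hl)) j).mul continuousAt_const
      filter_upwards [hc.eventually_const_lt (u := 0) (mul_self_pos.2 h0)] with l' hl' _ using hl'
  filter_upwards [hloc, hj] with l' h1 h2
  ext j
  by_cases h0 : coef X y l j = 0
  · have : coef X y l' j = 0 := by
      by_contra h3
      have := mem_active.2 h3
      rw [h1, mem_active] at this
      exact this h0
    simp [sgn, h0, this]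
  · rcases pos_and_pos_or_neg_and_neg_of_mul_pos (h2 j h0) with ⟨a, b⟩ | ⟨a, b⟩
    · simp [sgn, Real.sign_of_pos, a, b]
    · simp [sgn, Real.sign_of_neg, a, b]

theorem sgn_eq_of_isPreconnected {X : Matrix (Fin n) (Fin p) ℝ}
    (hX : LinearIndependent ℝ X.col) {y : Fin n → ℝ} {U : Set ℝ} (hU : IsPreconnected U)
    (hpos : ∀ l ∈ U, 0 < l) (h : ∀ l ∈ U, l ∉ transitionPoints X y) {a b : ℝ} (ha : a ∈ U)
    (hb : b ∈ U) : sgn X y a = sgn X y b :=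
  hU.induction₂ (fun a b => sgn X y a = sgn X y b)
    (fun l hl => ((eventually_sgn_eq hX (hpos l hl) (h l hl)).filter_mono
      nhdsWithin_le_nhds).mono fun _ => Eq.symm)
    (fun _ _ _ _ _ _ => Eq.trans) (fun _ _ _ _ => Eq.symm) ha hb

theorem zero_mem_transitionPoints (X : Matrix (Fin n) (Fin p) ℝ) (y : Fin n → ℝ) :
    (0 : ℝ) ∈ transitionPoints X y := Or.inl rfl

theorem nonneg_of_mem_transitionPoints {X : Matrix (Fin n) (Fin p) ℝ} {y : Fin n → ℝ} {l : ℝ}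
    (h : l ∈ transitionPoints X y) : 0 ≤ l := h.elim (fun h => h.ge) fun h => h.1.le

section knots

variable {X : Matrix (Fin n) (Fin p) ℝ} (hX : LinearIndependent ℝ X.col) (y : Fin n → ℝ)
include hX

theorem lastIndex_add_one :
    lastIndex X y + 1 = ((finite_transitionPoints hX y).toFinset.sort (· ≥ ·)).length := by
  rw [Finset.length_sort, lastIndex, Set.ncard_eq_toFinset_card _ (finite_transitionPoints hX y)]
  refine Nat.succ_pred_eq_of_pos (Finset.card_pos.2 ⟨0, ?_⟩)
  simpa using zero_mem_transitionPoints X y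

theorem knot_eq_getElem {m : ℕ} (hm : m ≤ lastIndex X y) :
    knot X y m = ((finite_transitionPoints hX y).toFinset.sort (· ≥ ·))[m]'(by
      rw [← lastIndex_add_one hX y]; omega) := by
  rw [knot, dif_pos (finite_transitionPoints hX y), List.getD_eq_getElem]

theorem knot_of_lastIndex_lt {m : ℕ} (hm : lastIndex X y < m) : knot X y m = 0 := by
  rw [knot, dif_pos (finite_transitionPoints hX y), List.getD_eq_default]
  rw [← lastIndex_add_one hX y]; omega

theorem knot_mem {m : ℕ} (hm : m ≤ lastIndex X y) : knot X y m ∈ transitionPoints X y := by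
  rw [knot_eq_getElem hX y hm, ← (finite_transitionPoints hX y).mem_toFinset,
    ← Finset.mem_sort (· ≥ ·)]
  exact List.getElem_mem _

theorem knot_lt {m m' : ℕ} (h : m < m') (hm : m' ≤ lastIndex X y) :
    knot X y m' < knot X y m := by
  rw [knot_eq_getElem hX y hm, knot_eq_getElem hX y (h.le.trans hm)]
  exact (List.sortedGT_iff_getElem_gt_getElem_of_lt.1 (Finset.sortedGT_sort _)) h

theorem exists_knot {l : ℝ} (hl : l ∈ transitionPoints X y) :
    ∃ m ≤ lastIndex X y, knot X y m = l := by
  rw [← (finite_transitionPoints hX y).mem_toFinset, ← Finset.mem_sort (· ≥ ·)] at hl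
  obtain ⟨m, hm, h⟩ := List.getElem_of_mem hl
  have hm' := hm
  rw [← lastIndex_add_one hX y] at hm'
  exact ⟨m, by omega, by rw [knot_eq_getElem hX y (by omega), h]⟩

theorem knot_nonneg {m : ℕ} : 0 ≤ knot X y m := by
  rcases le_or_gt m (lastIndex X y) with h | h
  · exact nonneg_of_mem_transitionPoints (knot_mem hX y h)
  · rw [knot_of_lastIndex_lt hX y h]

theorem knot_lastIndex : knot X y (lastIndex X y) = 0 := by
  obtain ⟨m, hm, h⟩ := exists_knot hX y (zero_mem_transitionPoints X y)
  rcases hm.eq_or_lt with rfl | h1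
  · exact h
  · exact absurd (knot_lt hX y h1 le_rfl) (by rw [h]; exact (knot_nonneg hX y).not_gt)

theorem knot_pos {m : ℕ} (hm : m < lastIndex X y) : 0 < knot X y m :=
  (knot_nonneg hX y).trans_lt (knot_lt hX y (Nat.lt_succ_self m) hm)

theorem knot_antitone {m m' : ℕ} (h : m ≤ m') : knot X y m' ≤ knot X y m := by
  rcases h.eq_or_lt with rfl | h1
  · exact le_rfl
  rcases le_or_gt m' (lastIndex X y) with h2 | h2
  · exact (knot_lt hX y h1 h2).le
  · rw [knot_of_lastIndex_lt hX y h2]; exact knot_nonneg hX y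

theorem not_mem_transitionPoints_of_mem_Ioo {m : ℕ} {l : ℝ}
    (hl : l ∈ Set.Ioo (knot X y (m + 1)) (knot X y m)) : l ∉ transitionPoints X y := by
  intro h
  obtain ⟨m', -, rfl⟩ := exists_knot hX y h
  rcases le_or_gt m' m with h1 | h1
  · exact (knot_antitone hX y h1).not_gt hl.2
  · exact (knot_antitone hX y (Nat.succ_le_of_lt h1)).not_gt hl.1

theorem not_mem_transitionPoints_of_knot_zero_lt {l : ℝ} (hl : knot X y 0 < l) :
    l ∉ transitionPoints X y := by
  intro h
  obtain ⟨m', -, rfl⟩ := exists_knot hX y h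
  exact (knot_antitone hX y (Nat.zero_le _)).not_gt hl

theorem midpt_mem_Ioo {m : ℕ} (hm : m < lastIndex X y) :
    midpt X y m ∈ Set.Ioo (knot X y (m + 1)) (knot X y m) := by
  have := knot_lt hX y (Nat.lt_succ_self m) hm
  constructor <;> rw [midpt] <;> linarith

theorem sgn_eq_intervalSgn {m : ℕ} (hm : m < lastIndex X y) {l : ℝ}
    (hl : l ∈ Set.Ioo (knot X y (m + 1)) (knot X y m)) : sgn X y l = intervalSgn X y m :=
  sgn_eq_of_isPreconnected hX isPreconnected_Ioo
    (fun _ h => (knot_nonneg hX y).trans_lt h.1)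
    (fun _ h => not_mem_transitionPoints_of_mem_Ioo hX y h) hl (midpt_mem_Ioo hX y hm)

theorem active_eq_intervalActive {m : ℕ} (hm : m < lastIndex X y) {l : ℝ}
    (hl : l ∈ Set.Ioo (knot X y (m + 1)) (knot X y m)) :
    active X y l = intervalActive X y m :=
  active_congr (sgn_eq_intervalSgn hX y hm hl)

theorem coef_eq_zero_of_knot_zero_lt {l : ℝ} (hl : knot X y 0 < l) : coef X y l = 0 := by
  obtain ⟨L, hL⟩ : ∃ L, ∀ j, |score X y 0 j| ≤ L :=
    ⟨‖score X y 0‖, fun j => norm_le_pi_norm (score X y 0) j⟩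
  have hmax : max L l ∈ Set.Ioi (knot X y 0) := hl.trans_le (le_max_right _ _)
  have h0 : coef X y (max L l) = 0 :=
    KKT.coef_eq hX ((knot_nonneg hX y).trans hmax.le)
      fun j => ⟨(hL j).trans (le_max_left _ _), by simp⟩
  have h1 : sgn X y l = sgn X y (max L l) :=
    sgn_eq_of_isPreconnected hX isPreconnected_Ioi
      (fun _ h => (knot_nonneg hX y).trans_lt h)
      (fun _ h => not_mem_transitionPoints_of_knot_zero_lt hX y h) hl hmax
  ext j
  have := congrFun h1 j
  rw [sgn, sgn, h0, Pi.zero_apply, Real.sign_zero, Real.sign_eq_zero_iff] at this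
  rw [this, Pi.zero_apply]

theorem coef_knot_zero : coef X y (knot X y 0) = 0 := by
  have h1 : Filter.Tendsto (coef X y) (nhdsWithin (knot X y 0) (Set.Ioi (knot X y 0)))
      (nhds (coef X y (knot X y 0))) :=
    ((continuousOn_coef hX y) _ (knot_nonneg hX y)).mono
      fun l hl => (knot_nonneg hX y).trans (le_of_lt hl)
  have h2 : Filter.Tendsto (coef X y) (nhdsWithin (knot X y 0) (Set.Ioi (knot X y 0)))
      (nhds 0) :=
    tendsto_const_nhds.congr' (by
      filter_upwards [self_mem_nhdsWithin] with l hl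
      exact (coef_eq_zero_of_knot_zero_lt hX y hl).symm)
  exact tendsto_nhds_unique h1 h2

end knots

/-- Extension by zero of a vector indexed by a set of predictors. -/
def extend (A : Finset (Fin p)) (c : A → ℝ) (j : Fin p) : ℝ := if h : j ∈ A then c ⟨j, h⟩ else 0

@[simp]
theorem extend_coe (A : Finset (Fin p)) (c : A → ℝ) (j : A) : extend A c j = c j := by
  simp [extend]

theorem extend_of_notMem {A : Finset (Fin p)} (c : A → ℝ) {j : Fin p} (h : j ∉ A) :
    extend A c j = 0 := dif_neg h

theorem cols_mulVec (X : Matrix (Fin n) (Fin p) ℝ) (A : Finset (Fin p)) (c : A → ℝ) :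
    cols X A *ᵥ c = X *ᵥ extend A c := by
  ext i
  simp only [Matrix.mulVec, dotProduct, cols, Matrix.submatrix_apply, id]
  rw [← Finset.sum_subset (Finset.subset_univ A)
    (fun j _ hj => by rw [extend_of_notMem c hj, mul_zero]),
    ← Finset.sum_coe_sort A fun j => X i j * extend A c j]
  simp

theorem extend_restrict {A : Finset (Fin p)} {b : Fin p → ℝ} (h : ∀ j ∉ A, b j = 0) :
    extend A (fun j : A => b j) = b := by
  ext j
  by_cases hj : j ∈ A
  · simp [extend, hj]
  · rw [extend_of_notMem _ hj, h j hj]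

section projection

variable {X : Matrix (Fin n) (Fin p) ℝ} (hX : LinearIndependent ℝ X.col) (A : Finset (Fin p))
include hX

theorem mulVec_cols_injective : Function.Injective (cols X A).mulVec := by
  intro b c h
  rw [cols_mulVec, cols_mulVec] at h
  have := Matrix.mulVec_injective_iff.2 hX h
  ext j
  simpa using congrFun this j

theorem posDef_gram : ((cols X A)ᵀ * cols X A).PosDef := by
  have := Matrix.PosDef.conjTranspose_mul_self _ (mulVec_cols_injective hX A)
  rwa [Matrix.conjTranspose_eq_transpose_of_trivial] at this

theorem isUnit_det_gram : IsUnit ((cols X A)ᵀ * cols X A).det :=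
  (Matrix.isUnit_iff_isUnit_det _).1 (posDef_gram hX A).isUnit

theorem hat_mul_cols : hat X A * cols X A = cols X A := by
  rw [hat, Matrix.mul_assoc, Matrix.mul_assoc, Matrix.nonsing_inv_mul _ (isUnit_det_gram hX A),
    Matrix.mul_one]

theorem trace_hat : (hat X A).trace = A.card := by
  rw [hat, Matrix.mul_assoc, Matrix.trace_mul_comm, Matrix.mul_assoc,
    Matrix.nonsing_inv_mul _ (isUnit_det_gram hX A), Matrix.trace_one, Fintype.card_coe]

omit hX in
theorem transpose_hat : (hat X A)ᵀ = hat X A := by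
  rw [hat, Matrix.transpose_mul, Matrix.transpose_mul, Matrix.transpose_transpose,
    Matrix.transpose_nonsing_inv, Matrix.transpose_mul, Matrix.transpose_transpose,
    Matrix.mul_assoc]

theorem eq_zero_of_vecMul_one_sub_hat {v : Fin p → ℝ} (h : (X *ᵥ v) ᵥ* (1 - hat X A) = 0)
    {i : Fin p} (hi : i ∉ A) : v i = 0 := by
  rw [← Matrix.mulVec_transpose, Matrix.transpose_sub, Matrix.transpose_one, transpose_hat,
    Matrix.sub_mulVec, Matrix.one_mulVec, sub_eq_zero, hat, Matrix.mul_assoc,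
    ← Matrix.mulVec_mulVec, cols_mulVec] at h
  rw [Matrix.mulVec_injective_iff.2 hX h, extend_of_notMem _ hi]

end projection

/-- The residual of the predictor `i` after projection onto the predictors in `A`. -/
def resid (X : Matrix (Fin n) (Fin p) ℝ) (A : Finset (Fin p)) (i : Fin p) : Fin n → ℝ :=
  X.col i ᵥ* (1 - hat X A)

/-- The vector `X_A (X_Aᵀ X_A)⁻¹ s_A`. -/
def dir (X : Matrix (Fin n) (Fin p) ℝ) (A : Finset (Fin p)) (s : Fin p → ℝ) : Fin n → ℝ :=
  cols X A *ᵥ (((cols X A)ᵀ * cols X A)⁻¹ *ᵥ fun j => s j)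

/-- The scalar `e - x_iᵀ X_A (X_Aᵀ X_A)⁻¹ s_A`. -/
def denom (X : Matrix (Fin n) (Fin p) ℝ) (A : Finset (Fin p)) (s : Fin p → ℝ) (e : ℝ)
    (i : Fin p) : ℝ :=
  e - X.col i ⬝ᵥ dir X A s

/-- The matrix mapping the response to the fit at which the predictor `i` joins `A`. -/
def selector (X : Matrix (Fin n) (Fin p) ℝ) (A : Finset (Fin p)) (s : Fin p → ℝ) (e : ℝ)
    (i : Fin p) : Matrix (Fin n) (Fin n) ℝ :=
  hat X A - (1 / denom X A s e i) • Matrix.vecMulVec (dir X A s) (resid X A i)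

theorem stepDenom_eq (X : Matrix (Fin n) (Fin p) ℝ) (y : Fin n → ℝ) (m : ℕ) (i : Fin p) :
    stepDenom X y m i = denom X (active X y (knot X y m)) (sgn X y (knot X y m))
      (intervalSgn X y m i) i := rfl

theorem stepMatrix_eq (X : Matrix (Fin n) (Fin p) ℝ) (y : Fin n → ℝ) (m : ℕ) (i : Fin p) :
    stepMatrix X y m i = selector X (active X y (knot X y m)) (sgn X y (knot X y m))
      (intervalSgn X y m i) i := rfl

theorem resid_dotProduct (X : Matrix (Fin n) (Fin p) ℝ) (A : Finset (Fin p)) (i : Fin p)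
    (y : Fin n → ℝ) : resid X A i ⬝ᵥ y = X.col i ⬝ᵥ (y - hat X A *ᵥ y) := by
  rw [resid, ← Matrix.dotProduct_mulVec, Matrix.sub_mulVec, Matrix.one_mulVec]

section fit

variable {X : Matrix (Fin n) (Fin p) ℝ} (hX : LinearIndependent ℝ X.col)
include hX

theorem resid_dotProduct_dir (A : Finset (Fin p)) (s : Fin p → ℝ) (i : Fin p) :
    resid X A i ⬝ᵥ dir X A s = 0 := by
  rw [resid_dotProduct, dir, Matrix.mulVec_mulVec (M := hat X A), hat_mul_cols hX, sub_self,
    dotProduct_zero]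

theorem trace_selector (A : Finset (Fin p)) (s : Fin p → ℝ) (e : ℝ) (i : Fin p) :
    (selector X A s e i).trace = A.card := by
  rw [selector, Matrix.trace_sub, Matrix.trace_smul, Matrix.trace_vecMulVec, dotProduct_comm,
    resid_dotProduct_dir hX, trace_hat hX, smul_zero, sub_zero]

theorem fit_eq (y : Fin n → ℝ) {l : ℝ} (hl : 0 ≤ l) :
    fit X y l = hat X (active X y l) *ᵥ y - (l / 2) • dir X (active X y l) (sgn X y l) := by
  set A := active X y l with hA
  set b : A → ℝ := fun j => coef X y l j
  have hfit : fit X y l = cols X A *ᵥ b := by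
    rw [cols_mulVec, extend_restrict (fun j hj => by simpa [hA] using hj), fit]
  have h1 : (cols X A)ᵀ *ᵥ (y - cols X A *ᵥ b) = (l / 2) • fun j : A => sgn X y l j := by
    ext j
    have := corr_of_mem_active hX y hl j.2
    rw [corr, score, Pi.smul_apply, ← fit, hfit, smul_eq_mul] at this
    have e : ((cols X A)ᵀ *ᵥ (y - cols X A *ᵥ b)) j = (Xᵀ *ᵥ (y - cols X A *ᵥ b)) j := rfl
    rw [e, Pi.smul_apply, smul_eq_mul]
    linarith
  have h2 : hat X A *ᵥ y - cols X A *ᵥ b = (l / 2) • dir X A (sgn X y l) := by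
    have h3 : cols X A *ᵥ b = hat X A *ᵥ (cols X A *ᵥ b) := by
      rw [Matrix.mulVec_mulVec, hat_mul_cols hX]
    rw [h3, ← Matrix.mulVec_sub, hat, ← Matrix.mulVec_mulVec, h1, dir, Matrix.mulVec_smul,
      Matrix.mulVec_mulVec]
  rw [hfit, ← h2, sub_sub_cancel]

theorem resid_dotProduct_eq (y : Fin n → ℝ) {l : ℝ} (hl : 0 ≤ l) {i : Fin p} {e : ℝ}
    (h : corr X y l i = l * e) :
    resid X (active X y l) i ⬝ᵥ y = l / 2 * denom X (active X y l) (sgn X y l) e i := by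
  have h1 : corr X y l i = 2 * (X.col i ⬝ᵥ (y - fit X y l)) := rfl
  rw [h, fit_eq hX y hl, ← sub_add, dotProduct_add, ← resid_dotProduct, dotProduct_smul,
    smul_eq_mul] at h1
  rw [denom]
  linarith

theorem fit_eq_selector (y : Fin n → ℝ) {l : ℝ} (hl : 0 ≤ l) {i : Fin p} {e : ℝ}
    (h : corr X y l i = l * e) (hd : denom X (active X y l) (sgn X y l) e i ≠ 0) :
    fit X y l = selector X (active X y l) (sgn X y l) e i *ᵥ y := by
  rw [selector, Matrix.sub_mulVec, Matrix.smul_mulVec, Matrix.vecMulVec_mulVec, fit_eq hX y hl,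
    resid_dotProduct_eq hX y hl h]
  congr 1
  ext j
  simp
  field_simp

theorem corr_of_mem_intervalActive (y : Fin n → ℝ) {m : ℕ} (hm : m < lastIndex X y) {i : Fin p}
    (hi : i ∈ intervalActive X y m) {l : ℝ} (hl : l ∈ Set.Icc (knot X y (m + 1)) (knot X y m)) :
    corr X y l i = l * intervalSgn X y m i := by
  have hlt := knot_lt hX y (Nat.lt_succ_self m) hm
  have h0 := knot_nonneg hX y (m := m + 1)
  have h1 : Set.EqOn (fun l => corr X y l i) (fun l => l * intervalSgn X y m i)
      (Set.Icc (knot X y (m + 1)) (knot X y m)) := by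
    rw [← closure_Ioo hlt.ne]
    refine Set.EqOn.of_subset_closure (s := Set.Ioo (knot X y (m + 1)) (knot X y m)) ?_ ?_ ?_
      subset_closure subset_rfl
    · intro l hl
      have hl0 : 0 ≤ l := h0.trans hl.1.le
      have hi' : i ∈ active X y l := by rwa [active_eq_intervalActive hX y hm hl]
      change corr X y l i = _
      rw [corr_of_mem_active hX y hl0 hi', sgn_eq_intervalSgn hX y hm hl]
    · rw [closure_Ioo hlt.ne]
      exact (continuousOn_pi.1 (continuousOn_corr hX y) i).mono fun l hl => h0.trans hl.1
    · fun_prop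
  exact h1 hl

theorem lt_lastIndex_of_mem_joining {y : Fin n → ℝ} {m : ℕ} (hm : m ≤ lastIndex X y) {i : Fin p}
    (hi : i ∈ joining X y m) : m < lastIndex X y := by
  refine hm.lt_of_ne ?_
  rintro rfl
  rw [joining, intervalActive, midpt, knot_of_lastIndex_lt hX y (Nat.lt_succ_self _),
    knot_lastIndex hX y] at hi
  simp at hi

theorem corr_of_mem_joining {y : Fin n → ℝ} {m : ℕ} (hm : m ≤ lastIndex X y) {i : Fin p}
    (hi : i ∈ joining X y m) :
    corr X y (knot X y m) i = knot X y m * intervalSgn X y m i := by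
  have hm' := lt_lastIndex_of_mem_joining hX hm hi
  exact corr_of_mem_intervalActive hX y hm' (Finset.mem_sdiff.1 hi).1
    ⟨(knot_lt hX y (Nat.lt_succ_self m) hm').le, le_rfl⟩

theorem lt_lastIndex_of_mem_leaving {y : Fin n → ℝ} {m : ℕ} (hm : m ≤ lastIndex X y) {i : Fin p}
    (hi : i ∈ leaving X y m) : m < lastIndex X y := by
  refine hm.lt_of_ne ?_
  rintro rfl
  rw [leaving, intervalActive, midpt, knot_of_lastIndex_lt hX y (Nat.lt_succ_self _),
    knot_lastIndex hX y] at hi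
  simp at hi

theorem corr_of_mem_leaving {y : Fin n → ℝ} {m : ℕ} (hm : m ≤ lastIndex X y) {i : Fin p}
    (hi : i ∈ leaving X y m) :
    corr X y (knot X y (m + 1)) i = knot X y (m + 1) * intervalSgn X y m i := by
  have hm' := lt_lastIndex_of_mem_leaving hX hm hi
  exact corr_of_mem_intervalActive hX y hm' (Finset.mem_sdiff.1 hi).1
    ⟨le_rfl, (knot_lt hX y (Nat.lt_succ_self m) hm').le⟩

end fit

theorem exists_signType (r : ℝ) : ∃ s : SignType, Real.sign r = s := by
  rcases Real.sign_apply_eq r with h | h | h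
  · exact ⟨-1, by simp [h]⟩
  · exact ⟨0, by simp [h]⟩
  · exact ⟨1, by simp [h]⟩

theorem exists_sgn_eq (X : Matrix (Fin n) (Fin p) ℝ) (y : Fin n → ℝ) (l : ℝ) :
    ∃ s : Fin p → SignType, sgn X y l = fun j => (s j : ℝ) := by
  choose s hs using fun j => exists_signType (coef X y l j)
  exact ⟨s, funext hs⟩

open Classical in
/-- Normal vectors of finitely many hyperplanes that contain all responses for which two predictors
enter or leave the lasso path at the same point. -/
def normals (X : Matrix (Fin n) (Fin p) ℝ) : Finset (Fin n → ℝ) :=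
  ((Finset.univ.image fun q : Finset (Fin p) × Fin p => resid X q.1 q.2) ∪
    (Finset.univ.image fun q :
        Finset (Fin p) × (Fin p → SignType) × (Fin p × SignType) × Fin p × SignType =>
      denom X q.1 (fun j => q.2.1 j) q.2.2.2.2 q.2.2.2.1 • resid X q.1 q.2.2.1.1 -
        denom X q.1 (fun j => q.2.1 j) q.2.2.1.2 q.2.2.1.1 • resid X q.1 q.2.2.2.1)).filter (· ≠ 0)

/-- The response lies on none of the exceptional hyperplanes. -/
def Generic (X : Matrix (Fin n) (Fin p) ℝ) (y : Fin n → ℝ) : Prop :=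
  ∀ a ∈ normals X, a ⬝ᵥ y ≠ 0

section generic

variable {X : Matrix (Fin n) (Fin p) ℝ} (hX : LinearIndependent ℝ X.col)
include hX

theorem smul_resid_ne_zero {A : Finset (Fin p)} {i j : Fin p} (hi : i ∉ A) (hij : i ≠ j) {c d : ℝ}
    (hc : c ≠ 0) : c • resid X A i - d • resid X A j ≠ 0 := by
  intro h
  have h1 := eq_zero_of_vecMul_one_sub_hat hX A (v := c • Pi.single i 1 - d • Pi.single j 1)
    (by rw [← h, resid, resid, Matrix.mulVec_sub, Matrix.mulVec_smul, Matrix.mulVec_smul,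
          Matrix.mulVec_single_one, Matrix.mulVec_single_one, Matrix.sub_vecMul,
          Matrix.smul_vecMul, Matrix.smul_vecMul]) hi
  simp [hij] at h1
  exact hc h1

theorem resid_ne_zero {A : Finset (Fin p)} {i : Fin p} (hi : i ∉ A) : resid X A i ≠ 0 := by
  intro h
  have h1 := eq_zero_of_vecMul_one_sub_hat hX A (v := Pi.single i 1)
    (by rw [Matrix.mulVec_single_one]; exact h) hi
  simp at h1

theorem Generic.resid_dotProduct_ne_zero {y : Fin n → ℝ} (hy : Generic X y) {A : Finset (Fin p)}
    {i : Fin p} (hi : i ∉ A) : resid X A i ⬝ᵥ y ≠ 0 := by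
  classical
  exact hy _ (Finset.mem_filter.2 ⟨Finset.mem_union_left _ (Finset.mem_image.2
    ⟨(A, i), Finset.mem_univ _, rfl⟩), resid_ne_zero hX hi⟩)

theorem Generic.ne_zero {y : Fin n → ℝ} (hy : Generic X y) {l : ℝ} (hl : 0 ≤ l) {i : Fin p}
    (hi : i ∉ active X y l) {e : ℝ} (h : corr X y l i = l * e) :
    l ≠ 0 ∧ denom X (active X y l) (sgn X y l) e i ≠ 0 := by
  have h1 := hy.resid_dotProduct_ne_zero hX hi
  rw [resid_dotProduct_eq hX y hl h] at h1
  exact ⟨fun h0 => h1 (by simp [h0]), fun h0 => h1 (by simp [h0])⟩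

theorem Generic.eq_of_corr {y : Fin n → ℝ} (hy : Generic X y) {l : ℝ} (hl : 0 ≤ l) {i j : Fin p}
    (hi : i ∉ active X y l) (hj : j ∉ active X y l) {e f : SignType}
    (he : corr X y l i = l * e) (hf : corr X y l j = l * f) : i = j := by
  classical
  by_contra hij
  obtain ⟨s, hs⟩ := exists_sgn_eq X y l
  have hd := (hy.ne_zero hX hl hj hf).2
  refine hy (denom X (active X y l) (sgn X y l) f j • resid X (active X y l) i -
    denom X (active X y l) (sgn X y l) e i • resid X (active X y l) j) ?_ ?_
  · refine Finset.mem_filter.2 ⟨Finset.mem_union_right _ (Finset.mem_image.2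
      ⟨(active X y l, s, (i, e), j, f), Finset.mem_univ _, by rw [hs]⟩),
      smul_resid_ne_zero hX hi hij hd⟩
  · rw [sub_dotProduct, smul_dotProduct, smul_dotProduct, resid_dotProduct_eq hX y hl he,
      resid_dotProduct_eq hX y hl hf]
    simp only [smul_eq_mul]
    ring

theorem Generic.card_joining_le {y : Fin n → ℝ} (hy : Generic X y) {m : ℕ}
    (hm : m ≤ lastIndex X y) : (joining X y m).card ≤ 1 := by
  refine Finset.card_le_one.2 fun i hi j hj => ?_
  obtain ⟨s, hs⟩ := exists_sgn_eq X y (midpt X y m)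
  have h1 := corr_of_mem_joining hX hm hi
  have h2 := corr_of_mem_joining hX hm hj
  rw [intervalSgn, hs] at h1 h2
  exact hy.eq_of_corr hX (knot_nonneg hX y) (Finset.mem_sdiff.1 hi).2 (Finset.mem_sdiff.1 hj).2
    h1 h2

theorem Generic.card_leaving_le {y : Fin n → ℝ} (hy : Generic X y) {m : ℕ}
    (hm : m ≤ lastIndex X y) : (leaving X y m).card ≤ 1 := by
  refine Finset.card_le_one.2 fun i hi j hj => ?_
  obtain ⟨s, hs⟩ := exists_sgn_eq X y (midpt X y m)
  have h1 := corr_of_mem_leaving hX hm hi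
  have h2 := corr_of_mem_leaving hX hm hj
  rw [intervalSgn, hs] at h1 h2
  exact hy.eq_of_corr hX (knot_nonneg hX y) (Finset.mem_sdiff.1 hi).2 (Finset.mem_sdiff.1 hj).2
    h1 h2

theorem Generic.stepDenom_ne_zero {y : Fin n → ℝ} (hy : Generic X y) {m : ℕ}
    (hm : m ≤ lastIndex X y) {i : Fin p} (hi : i ∈ joining X y m) : stepDenom X y m i ≠ 0 :=
  (hy.ne_zero hX (knot_nonneg hX y) (Finset.mem_sdiff.1 hi).2 (corr_of_mem_joining hX hm hi)).2

theorem Generic.active_zero {y : Fin n → ℝ} (hy : Generic X y) :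
    active X y 0 = Finset.univ := by
  by_contra h
  obtain ⟨i, hi⟩ : ∃ i, i ∉ active X y 0 := by
    by_contra! h'; exact h (Finset.eq_univ_iff_forall.2 h')
  refine (hy.ne_zero hX le_rfl hi (e := 0) ?_).1 rfl
  have := abs_corr_le hX y le_rfl i
  simpa using this

theorem active_knot_succ_subset (y : Fin n → ℝ) {m : ℕ} (hm : m < lastIndex X y) :
    active X y (knot X y (m + 1)) ⊆ intervalActive X y m := by
  intro j hj
  have hlt := knot_lt hX y (Nat.lt_succ_self m) hm
  have h0 := knot_nonneg hX y (m := m + 1)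
  have hc : ContinuousWithinAt (fun l => coef X y l j)
      (Set.Ioo (knot X y (m + 1)) (knot X y m)) (knot X y (m + 1)) :=
    ((continuousOn_pi.1 (continuousOn_coef hX y) j) _ h0).mono fun l hl => h0.trans hl.1.le
  have hne : (nhdsWithin (knot X y (m + 1)) (Set.Ioo (knot X y (m + 1)) (knot X y m))).NeBot :=
    left_nhdsWithin_Ioo_neBot hlt
  obtain ⟨l, hl, hl'⟩ :=
    ((hc.eventually_ne (mem_active.1 hj)).and self_mem_nhdsWithin).exists
  rw [← active_eq_intervalActive hX y hm hl']
  exact mem_active.2 hl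

theorem Generic.card_active_knot_succ_le {y : Fin n → ℝ} (hy : Generic X y) {m : ℕ}
    (hm : m < lastIndex X y) :
    (active X y (knot X y (m + 1))).card ≤ (active X y (knot X y m)).card + 1 := by
  calc (active X y (knot X y (m + 1))).card ≤ (intervalActive X y m).card :=
        Finset.card_le_card (active_knot_succ_subset hX y hm)
    _ ≤ (joining X y m).card + (active X y (knot X y m)).card :=
        Finset.card_le_card_sdiff_add_card
    _ ≤ _ := by have := hy.card_joining_le hX hm.le; omega

theorem Generic.stepsWith_nonempty {y : Fin n → ℝ} (hy : Generic X y) {k : ℕ} (hk : k ≤ p) :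
    (stepsWith X y k).Nonempty := by
  classical
  have hK : k ≤ (active X y (knot X y (lastIndex X y))).card := by
    rw [knot_lastIndex hX, hy.active_zero hX]; simpa using hk
  have hex : ∃ m, k ≤ (active X y (knot X y m)).card := ⟨_, hK⟩
  have hle : Nat.find hex ≤ lastIndex X y := Nat.find_min' hex hK
  refine ⟨Nat.find hex, hle, le_antisymm ?_ (Nat.find_spec hex)⟩
  rcases h : Nat.find hex with _ | m
  · have : active X y (knot X y 0) = ∅ := by
      ext j; simp [coef_knot_zero hX y]
    rw [this]; simp
  · have h1 := Nat.find_min hex (m := m) (by omega)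
    have h2 := hy.card_active_knot_succ_le hX (m := m) (by omega)
    omega

end generic

theorem PositiveCone.mul_inv_gram_pos {X : Matrix (Fin n) (Fin p) ℝ} (hpc : PositiveCone X)
    (A : Finset (Fin p)) {s : Fin p → ℝ} (hs : ∀ j, s j = 1 ∨ s j = -1) (i : A) :
    0 < s i * (((cols X A)ᵀ * cols X A)⁻¹ *ᵥ fun j : A => s j) i := by
  have h := hpc A s hs i
  set D : Matrix A A ℝ := Matrix.diagonal fun j : A => s j with hD
  have h1 : cols (X * Matrix.diagonal s) A = cols X A * D := by
    ext a b
    simp [cols, hD, Matrix.mul_diagonal]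
  have h2 : D * D = 1 := by
    rw [hD, Matrix.diagonal_mul_diagonal, ← Matrix.diagonal_one]
    congr 1
    ext j
    rcases hs j with h | h <;> simp [h]
  have h3 : D⁻¹ = D := Matrix.inv_eq_left_inv h2
  have h4 : Dᵀ = D := Matrix.diagonal_transpose _
  have h5 : (D *ᵥ 1 : A → ℝ) = fun j : A => s j := by
    ext j; simp [hD, Matrix.mulVec_diagonal]
  rw [h1, Matrix.transpose_mul, h4, Matrix.mul_assoc, ← Matrix.mul_assoc (cols X A)ᵀ,
    Matrix.mul_inv_rev, Matrix.mul_inv_rev, h3, ← Matrix.mulVec_mulVec, ← Matrix.mulVec_mulVec,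
    h5, hD, Matrix.mulVec_diagonal] at h
  exact h

/-- The predictors whose correlation with the residual is maximal. -/
def equi (X : Matrix (Fin n) (Fin p) ℝ) (y : Fin n → ℝ) (l : ℝ) : Finset (Fin p) :=
  {j | |corr X y l j| = l}

@[simp]
theorem mem_equi {X : Matrix (Fin n) (Fin p) ℝ} {y : Fin n → ℝ} {l : ℝ} {j : Fin p} :
    j ∈ equi X y l ↔ |corr X y l j| = l := by
  simp [equi]

section path

variable {X : Matrix (Fin n) (Fin p) ℝ} (hX : LinearIndependent ℝ X.col)
include hX

theorem active_subset_equi (y : Fin n → ℝ) {l : ℝ} (hl : 0 ≤ l) : active X y l ⊆ equi X y l :=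
  fun _ hj => mem_equi.2 (abs_corr_of_mem_active hX y hl hj)

theorem exists_left_step (hpc : PositiveCone X) (y : Fin n → ℝ) {l : ℝ} (hl : 0 < l) :
    ∃ e : Fin p → ℝ, (∀ j ∈ equi X y l, 0 < corr X y l j * e j) ∧
      ∀ᶠ δ in nhdsWithin (0 : ℝ) (Set.Ioi 0),
        coef X y (l - δ) = coef X y l + (δ / 2) • e := by
  set E := equi X y l with hE
  set s : Fin p → ℝ := fun j => if corr X y l j < 0 then -1 else 1 with hs
  have hs1 : ∀ j, s j = 1 ∨ s j = -1 := fun j => by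
    simp only [hs]; split_ifs <;> simp
  have hss : ∀ j, s j * s j = 1 := fun j => by rcases hs1 j with h | h <;> simp [h]
  have hsabs : ∀ j, |s j| = 1 := fun j => by rcases hs1 j with h | h <;> simp [h]
  have hcorr : ∀ j ∈ E, corr X y l j = l * s j := by
    intro j hj
    have h := mem_equi.1 hj
    simp only [hs]
    split_ifs with h0
    · rw [abs_of_neg h0] at h; linarith
    · rw [abs_of_nonneg (not_lt.1 h0)] at h; linarith
  set c : E → ℝ := ((cols X E)ᵀ * cols X E)⁻¹ *ᵥ fun j : E => s j with hc
  set e := extend E c with he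
  have hse : ∀ j ∈ E, 0 < s j * e j := by
    intro j hj
    have := hpc.mul_inv_gram_pos E hs1 ⟨j, hj⟩
    rwa [← hc, ← extend_coe E c, ← he] at this
  set g : Fin p → ℝ := Xᵀ *ᵥ (X *ᵥ e) with hg
  have hgE : ∀ j ∈ E, g j = s j := by
    intro j hj
    have h1 : (cols X E)ᵀ *ᵥ (cols X E *ᵥ c) = fun j : E => s j := by
      rw [Matrix.mulVec_mulVec, hc, Matrix.mulVec_mulVec,
        Matrix.mul_nonsing_inv _ (isUnit_det_gram hX E), Matrix.one_mulVec]
    rw [cols_mulVec] at h1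
    exact congrFun h1 ⟨j, hj⟩
  have hscore : ∀ δ j, score X y (coef X y l + (δ / 2) • e) j = corr X y l j - δ * g j := by
    intro δ j
    rw [score, Matrix.mulVec_add, ← sub_sub, Matrix.mulVec_sub, Matrix.mulVec_smul,
      Matrix.mulVec_smul, ← hg, corr, score]
    simp only [Pi.smul_apply, Pi.sub_apply, smul_eq_mul]
    ring
  refine ⟨e, fun j hj => ?_, ?_⟩
  · rw [hcorr j hj, mul_assoc]; exact mul_pos hl (hse j hj)
  have hout : ∀ᶠ δ in nhds (0 : ℝ), ∀ j, j ∉ E → |corr X y l j - δ * g j| < l - δ := by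
    rw [Filter.eventually_all]
    intro j
    by_cases hj : j ∈ E
    · simp [hj]
    have h1 : |corr X y l j| < l :=
      (abs_corr_le hX y hl.le j).lt_of_ne fun h => hj (mem_equi.2 h)
    have h2 : ContinuousAt (fun δ : ℝ => l - δ - |corr X y l j - δ * g j|) 0 := by fun_prop
    filter_upwards [h2.eventually_const_lt (u := 0) (by simpa using h1)] with δ hδ _
    linarith
  filter_upwards [self_mem_nhdsWithin, nhdsWithin_le_nhds hout,
    nhdsWithin_le_nhds (gt_mem_nhds hl)] with δ hδ0 hδ hδl
  have hδ0 : 0 < δ := hδ0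
  refine KKT.coef_eq hX (by linarith) fun j => ?_
  rw [hscore]
  by_cases hj : j ∈ E
  · have h1 : s j * coef X y l j = |coef X y l j| := by
      have := (kkt_coef hX y hl.le j).2
      change corr X y l j * _ = _ at this
      rw [hcorr j hj, mul_assoc] at this
      exact mul_left_cancel₀ hl.ne' this
    have h2 : 0 ≤ s j * (coef X y l + (δ / 2) • e) j := by
      simp only [Pi.add_apply, Pi.smul_apply, smul_eq_mul]
      have := hse j hj
      have h3 : 0 ≤ s j * coef X y l j := h1 ▸ abs_nonneg _
      nlinarith
    have h3 : |(coef X y l + (δ / 2) • e) j| = s j * (coef X y l + (δ / 2) • e) j := by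
      rw [← abs_of_nonneg h2, abs_mul, hsabs, one_mul]
    have h4 : corr X y l j - δ * g j = (l - δ) * s j := by
      rw [hcorr j hj, hgE j hj]; ring
    rw [h3, h4]
    exact ⟨by rw [abs_mul, hsabs, mul_one, abs_of_nonneg (by linarith)], by ring⟩
  · have h1 : coef X y l j = 0 := by
      by_contra h
      exact hj (active_subset_equi hX y hl.le (mem_active.2 h))
    have h2 : (coef X y l + (δ / 2) • e) j = 0 := by
      simp [h1, he, extend_of_notMem c hj]
    rw [h2]
    exact ⟨(hδ j hj).le, by simp⟩

theorem equi_subset_active (hpc : PositiveCone X) (y : Fin n → ℝ) {t l : ℝ} (ht : 0 ≤ t)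
    (htl : t < l) : equi X y l ⊆ active X y t := by
  intro j hj
  have hl : 0 < l := ht.trans_lt htl
  set c := corr X y l j
  set f : ℝ → ℝ := fun u => c * coef X y u j with hf
  have hcont : ContinuousOn f (Set.Icc t l) :=
    continuousOn_const.mul ((continuousOn_pi.1 (continuousOn_coef hX y) j).mono
      fun u hu => ht.trans hu.1)
  have hpos : ∃ u ∈ Set.Icc t l, 0 < f u := by
    obtain ⟨e, he, hstep⟩ := exists_left_step hX hpc y hl
    obtain ⟨δ, hδ, hδ0, hδt⟩ := (hstep.and (eventually_mem_nhdsWithin.and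
      ((gt_mem_nhds (sub_pos.2 htl)).filter_mono nhdsWithin_le_nhds))).exists
    have hδ0 : 0 < δ := hδ0
    refine ⟨l - δ, ⟨by linarith, by linarith⟩, ?_⟩
    have h1 : 0 ≤ c * coef X y l j := by
      have := (kkt_coef hX y hl.le j).2
      change c * coef X y l j = _ at this
      rw [this]; positivity
    have h2 := he j hj
    simp only [hf, hδ, Pi.add_apply, Pi.smul_apply, smul_eq_mul]
    change 0 < c * e j at h2
    nlinarith
  obtain ⟨u, hu, humax⟩ := isCompact_Icc.exists_isMaxOn ⟨t, Set.left_mem_Icc.2 htl.le⟩ hcont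
  have hfu : 0 < f u := by
    obtain ⟨v, hv, hv0⟩ := hpos
    exact hv0.trans_le (humax hv)
  have hcoef : coef X y u j ≠ 0 := fun h => by simp [hf, h] at hfu
  rcases hu.1.eq_or_lt with rfl | htu
  · exact mem_active.2 hcoef
  exfalso
  have hu0 : 0 < u := ht.trans_lt htu
  obtain ⟨e, he, hstep⟩ := exists_left_step hX hpc y hu0
  obtain ⟨δ, hδ, hδ0, hδt⟩ := (hstep.and (eventually_mem_nhdsWithin.and
    ((gt_mem_nhds (sub_pos.2 htu)).filter_mono nhdsWithin_le_nhds))).exists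
  have hδ0 : 0 < δ := hδ0
  have h1 : 0 < corr X y u j * e j :=
    he j (active_subset_equi hX y hu0.le (mem_active.2 hcoef))
  have h2 : 0 < corr X y u j * coef X y u j := by
    have := (kkt_coef hX y hu0.le j).2
    change corr X y u j * coef X y u j = _ at this
    rw [this]; positivity
  have h3 : 0 < c * e j := by
    have h4 : 0 < (corr X y u j * e j) * ((corr X y u j * coef X y u j) * f u) :=
      mul_pos h1 (mul_pos h2 hfu)
    have h5 : (corr X y u j * e j) * ((corr X y u j * coef X y u j) * f u) =
        (corr X y u j * coef X y u j) ^ 2 * (c * e j) := by simp only [hf]; ring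
    rw [h5] at h4
    exact pos_of_mul_pos_right h4 (sq_nonneg _)
  have h6 : f (u - δ) ≤ f u := humax ⟨by linarith, by linarith [hu.2]⟩
  simp only [hf, hδ, Pi.add_apply, Pi.smul_apply, smul_eq_mul] at h6
  nlinarith

theorem exists_mem_equi_sdiff_active (y : Fin n → ℝ) {l : ℝ} (hl : 0 < l)
    (h : l ∈ transitionPoints X y) : ∃ i ∈ equi X y l, i ∉ active X y l := by
  by_contra! hsub
  refine (h.resolve_left hl.ne').2 ?_
  have h1 : ∀ᶠ l' in nhds l, ∀ j, j ∈ active X y l → j ∈ active X y l' := by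
    rw [Filter.eventually_all]
    intro j
    by_cases hj : j ∈ active X y l
    · filter_upwards [((continuousAt_pi.1 (continuousAt_coef hX y hl)) j).eventually_ne
        (mem_active.1 hj)] with l' hl' _ using mem_active.2 hl'
    · simp [hj]
  have h2 : ∀ᶠ l' in nhds l, ∀ j, j ∉ equi X y l → j ∉ equi X y l' := by
    rw [Filter.eventually_all]
    intro j
    by_cases hj : j ∈ equi X y l
    · simp [hj]
    · have hc : ContinuousAt (fun l' => |corr X y l' j| - l') l :=
        ((continuousAt_pi.1 (continuousAt_corr hX y hl)) j).abs.sub continuousAt_id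
      have hne : |corr X y l j| - l ≠ 0 := fun h0 => hj (mem_equi.2 (sub_eq_zero.1 h0))
      filter_upwards [hc.eventually_ne hne] with l' hl' _ hmem
      exact hl' (sub_eq_zero.2 (mem_equi.1 hmem))
  filter_upwards [h1, h2, lt_mem_nhds hl] with l' h1 h2 hl'
  refine Finset.Subset.antisymm (fun j hj => hsub j ?_) h1
  by_contra hj'
  exact h2 j hj' (active_subset_equi hX y (le_of_lt hl') hj)

end path

/-- The smallest regularization parameter at which at most `k` coefficients are nonzero. -/
def kthKnot (X : Matrix (Fin n) (Fin p) ℝ) (k : ℕ) (y : Fin n → ℝ) : ℝ :=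
  sInf {l | 0 ≤ l ∧ (active X y l).card ≤ k}

section kthKnot

variable {X : Matrix (Fin n) (Fin p) ℝ} (hX : LinearIndependent ℝ X.col)

theorem kthKnot_nonneg (k : ℕ) (y : Fin n → ℝ) : 0 ≤ kthKnot X k y :=
  Real.sInf_nonneg fun _ h => h.1

theorem bddBelow_setOf_card_active_le (k : ℕ) (y : Fin n → ℝ) :
    BddBelow {l | 0 ≤ l ∧ (active X y l).card ≤ k} := ⟨0, fun _ h => h.1⟩

include hX

theorem nonempty_setOf_card_active_le (k : ℕ) (y : Fin n → ℝ) :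
    {l | 0 ≤ l ∧ (active X y l).card ≤ k}.Nonempty := by
  refine ⟨knot X y 0, knot_nonneg hX y, ?_⟩
  have : active X y (knot X y 0) = ∅ := by
    ext j; simp [coef_knot_zero hX y]
  simp [this]

theorem active_antitone (hpc : PositiveCone X) (y : Fin n → ℝ) {t l : ℝ} (ht : 0 ≤ t)
    (htl : t ≤ l) : active X y l ⊆ active X y t := by
  rcases htl.eq_or_lt with rfl | h
  · exact subset_rfl
  · exact (active_subset_equi hX y (ht.trans htl)).trans (equi_subset_active hX hpc y ht h)

theorem continuous_coef_left {l : ℝ} (hl : 0 ≤ l) : Continuous fun y => coef X y l := by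
  have h := (continuous_coef_max hX).comp (f := fun y : Fin n → ℝ => (y, l))
    (continuous_id.prodMk continuous_const)
  simpa [Function.comp_def, max_eq_left hl] using h

theorem continuous_corr_left {l : ℝ} (hl : 0 ≤ l) : Continuous fun y => corr X y l :=
  (continuous_score X).comp (f := fun y => (y, coef X y l))
    (continuous_id.prodMk (continuous_coef_left hX hl))

theorem continuous_kthKnot (hpc : PositiveCone X) (k : ℕ) : Continuous (kthKnot X k) := by
  refine continuous_iff_continuousAt.2 fun y => tendsto_order.2 ⟨fun a ha => ?_, fun a ha => ?_⟩
  · rcases lt_or_ge a 0 with ha0 | ha0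
    · exact Filter.Eventually.of_forall fun y' => ha0.trans_le (kthKnot_nonneg k y')
    obtain ⟨b, hab, hb⟩ := exists_between ha
    have hb0 : 0 ≤ b := ha0.trans hab.le
    have hkb : k < (active X y b).card := by
      by_contra! h
      exact (csInf_le (bddBelow_setOf_card_active_le k y) ⟨hb0, h⟩).not_gt hb
    have hsub : ∀ᶠ y' in nhds y, ∀ j, j ∈ active X y b → j ∈ active X y' b := by
      rw [Filter.eventually_all]
      intro j
      by_cases hj : j ∈ active X y b
      · have hc := (continuous_pi_iff.1 (continuous_coef_left hX hb0)) j
        filter_upwards [hc.continuousAt.eventually_ne (mem_active.1 hj)] with y' hy' _ using mem_active.2 hy'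
      · simp [hj]
    filter_upwards [hsub] with y' hy'
    refine hab.trans_le (le_csInf (nonempty_setOf_card_active_le hX k y') fun l hl => ?_)
    by_contra! hlb
    have h1 := Finset.card_le_card (active_antitone hX hpc y' hl.1 hlb.le)
    have h2 := Finset.card_le_card (s := active X y b) hy'
    have h3 := hl.2
    omega
  · obtain ⟨t, ⟨ht0, htk⟩, hta⟩ := exists_lt_of_csInf_lt (nonempty_setOf_card_active_le hX k y) ha
    obtain ⟨b, htb, hba⟩ := exists_between hta
    have hb0 : 0 ≤ b := ht0.trans htb.le
    have hsub : ∀ᶠ y' in nhds y, ∀ j, j ∉ equi X y b → j ∉ equi X y' b := by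
      rw [Filter.eventually_all]
      intro j
      by_cases hj : j ∈ equi X y b
      · simp [hj]
      · have hc : Continuous fun y' => |corr X y' b j| :=
          ((continuous_pi_iff.1 (continuous_corr_left hX hb0)) j).abs
        filter_upwards [hc.continuousAt.eventually_ne fun h => hj (mem_equi.2 h)] with y' hy' _ h
        exact hy' (mem_equi.1 h)
    filter_upwards [hsub] with y' hy'
    refine (csInf_le (bddBelow_setOf_card_active_le k y') ⟨hb0, ?_⟩).trans_lt hba
    refine le_trans (Finset.card_le_card fun j hj => ?_) htk
    refine equi_subset_active hX hpc y ht0 htb ?_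
    by_contra h
    exact hy' j h (active_subset_equi hX y' hb0 hj)

theorem continuous_fit_kthKnot (hpc : PositiveCone X) (k : ℕ) :
    Continuous fun y => fit X y (kthKnot X k y) := by
  have h := (continuous_coef_max hX).comp (f := fun y : Fin n → ℝ => (y, kthKnot X k y))
    (continuous_id.prodMk (continuous_kthKnot hX hpc k))
  have h' : Continuous fun y => coef X y (kthKnot X k y) := by
    simpa [Function.comp_def, max_eq_left (kthKnot_nonneg _ _)] using h
  exact continuous_const.matrix_mulVec h'

omit hX in
theorem lastStep_mem {y : Fin n → ℝ} {k : ℕ} (h : (stepsWith X y k).Nonempty) :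
    lastStep X y k ∈ stepsWith X y k :=
  Nat.sSup_mem h ⟨lastIndex X y, fun _ hm => hm.1⟩

theorem knot_lastStep (hpc : PositiveCone X) {y : Fin n → ℝ} {k : ℕ}
    (h : (stepsWith X y k).Nonempty) : knot X y (lastStep X y k) = kthKnot X k y := by
  obtain ⟨hm, hk⟩ := lastStep_mem h
  suffices IsLeast {l | 0 ≤ l ∧ (active X y l).card ≤ k} (knot X y (lastStep X y k)) from
    this.csInf_eq.symm
  refine ⟨⟨knot_nonneg hX y, hk.le⟩, fun l hl => ?_⟩
  rcases hm.eq_or_lt with hm | hm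
  · rw [hm, knot_lastIndex hX]; exact hl.1
  by_contra! hlt
  have hpos := knot_pos hX y hm
  obtain ⟨i, hi, hi'⟩ := exists_mem_equi_sdiff_active hX y hpos (knot_mem hX y hm.le)
  have h1 : active X y (knot X y (lastStep X y k)) ⊂ active X y l :=
    (Finset.ssubset_iff_of_subset (active_antitone hX hpc y hl.1 hlt.le)).2
      ⟨i, equi_subset_active hX hpc y hl.1 hlt hi, hi'⟩
  have h2 := Finset.card_lt_card h1
  have h3 := hl.2
  omega

end kthKnot

/-- Matrices mapping a response to its fit at the last step with `k` nonzero coefficients. -/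
def selectors (X : Matrix (Fin n) (Fin p) ℝ) (k : ℕ) : Set (Matrix (Fin n) (Fin n) ℝ) :=
  {S | ∃ A : Finset (Fin p), A.card = k ∧ (S = hat X A ∨
    ∃ (s : Fin p → SignType) (e : SignType) (i : Fin p), S = selector X A (fun j => s j) e i)}

theorem finite_selectors (X : Matrix (Fin n) (Fin p) ℝ) (k : ℕ) : (selectors X k).Finite := by
  refine ((Set.finite_range fun A => hat X A).union (Set.finite_range
    fun q : Finset (Fin p) × (Fin p → SignType) × SignType × Fin p =>
      selector X q.1 (fun j => q.2.1 j) q.2.2.1 q.2.2.2)).subset ?_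
  rintro S ⟨A, -, rfl | ⟨s, e, i, rfl⟩⟩
  · exact Or.inl ⟨A, rfl⟩
  · exact Or.inr ⟨(A, s, e, i), rfl⟩

theorem trace_of_mem_selectors {X : Matrix (Fin n) (Fin p) ℝ} (hX : LinearIndependent ℝ X.col)
    {k : ℕ} {S : Matrix (Fin n) (Fin n) ℝ} (hS : S ∈ selectors X k) : S.trace = k := by
  obtain ⟨A, rfl, rfl | ⟨s, e, i, rfl⟩⟩ := hS
  · exact trace_hat hX A
  · exact trace_selector hX A _ _ i

theorem Generic.exists_fit_kthKnot_eq {X : Matrix (Fin n) (Fin p) ℝ}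
    (hX : LinearIndependent ℝ X.col) (hpc : PositiveCone X) {y : Fin n → ℝ} (hy : Generic X y)
    {k : ℕ} (hk : k ≤ p) :
    ∃ S ∈ selectors X k, fit X y (kthKnot X k y) = S *ᵥ y := by
  have hne := hy.stepsWith_nonempty hX hk
  obtain ⟨hm, hcard⟩ := lastStep_mem hne
  rw [← knot_lastStep hX hpc hne]
  rcases hm.eq_or_lt with hm | hm
  · refine ⟨hat X (active X y (knot X y (lastStep X y k))), ⟨_, hcard, Or.inl rfl⟩, ?_⟩
    conv_lhs => rw [fit_eq hX y (knot_nonneg hX y)]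
    conv_lhs => enter [2, 1]; rw [hm, knot_lastIndex hX]
    simp
  · have hpos := knot_pos hX y hm
    obtain ⟨i, hi, hi'⟩ := exists_mem_equi_sdiff_active hX y hpos (knot_mem hX y hm.le)
    have hmid := midpt_mem_Ioo hX y hm
    have hjoin : i ∈ joining X y (lastStep X y k) :=
      Finset.mem_sdiff.2 ⟨equi_subset_active hX hpc y
        ((knot_nonneg hX y).trans hmid.1.le) hmid.2 hi, hi'⟩
    have hcorr := corr_of_mem_joining hX hm.le hjoin
    obtain ⟨s, hs⟩ := exists_sgn_eq X y (knot X y (lastStep X y k))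
    obtain ⟨e, he⟩ := exists_signType (coef X y (midpt X y (lastStep X y k)) i)
    have he' : intervalSgn X y (lastStep X y k) i = e := he
    rw [he'] at hcorr
    refine ⟨_, ⟨_, hcard, Or.inr ⟨s, e, i, rfl⟩⟩, ?_⟩
    rw [← hs]
    exact fit_eq_selector hX y hpos.le hcorr (hy.ne_zero hX hpos.le hi' hcorr).2

/-- A continuous function that agrees at each point with one of finitely many continuous linear
functionals is Lipschitz. -/
theorem exists_lipschitzWith_of_selection {E : Type*} [NormedAddCommGroup E] [NormedSpace ℝ E]
    {g : E → ℝ} (hg : Continuous g) {F : Set (E →L[ℝ] ℝ)} (hF : F.Finite)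
    (h : ∀ y, ∃ L ∈ F, g y = L y) : ∃ K : ℝ≥0, LipschitzWith K g := by
  obtain ⟨C, hC⟩ : ∃ C : ℝ≥0, ∀ L ∈ F, ‖L‖₊ ≤ C := by
    obtain ⟨C, hC⟩ := (hF.image fun L => ‖L‖₊).bddAbove
    exact ⟨C, fun L hL => hC ⟨L, hL, rfl⟩⟩
  refine ⟨C, LipschitzWith.of_dist_le_mul fun b a => ?_⟩
  set φ : ℝ → ℝ := fun t => g (a + t • (b - a)) with hφ
  have hφc : Continuous φ := by fun_prop
  set Z : Set ℝ := ⋃ L ∈ F, ⋃ M ∈ F,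
    {t | L (a + t • (b - a)) = M (a + t • (b - a)) ∧ L (b - a) ≠ M (b - a)} with hZ
  have hZc : Z.Countable := by
    refine hF.countable.biUnion fun L _ => hF.countable.biUnion fun M _ =>
      Set.Subsingleton.countable fun t ht u hu => ?_
    obtain ⟨h1, hne⟩ := ht
    have h2 := hu.1
    simp only [map_add, map_smul, smul_eq_mul] at h1 h2
    have h3 : (t - u) * (L (b - a) - M (b - a)) = 0 := by linarith
    exact sub_eq_zero.1 ((mul_eq_zero.1 h3).resolve_right (sub_ne_zero.2 hne))
  have hderiv : ∀ t ∉ Z, ∃ L ∈ F, HasDerivAt φ (L (b - a)) t := by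
    intro t ht
    obtain ⟨L, hL, hLt⟩ := h (a + t • (b - a))
    refine ⟨L, hL, ?_⟩
    have hloc : ∀ᶠ u in nhds t, ∀ M ∈ F, φ u = M (a + u • (b - a)) →
        φ u = L (a + u • (b - a)) := by
      rw [Filter.eventually_all_finite hF]
      intro M hM
      by_cases hMt : φ t = M (a + t • (b - a))
      · have hd : L (b - a) = M (b - a) := by
          by_contra hne
          exact ht (Set.mem_biUnion hL (Set.mem_biUnion hM ⟨hLt.symm.trans hMt, hne⟩))
        have h1 : L (a + t • (b - a)) = M (a + t • (b - a)) := hLt.symm.trans hMt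
        simp only [map_add, map_smul, hd] at h1 ⊢
        refine Filter.Eventually.of_forall fun u hu => ?_
        rw [hu, add_right_cancel h1]
      · have hc : Continuous fun u : ℝ => φ u - M (a + u • (b - a)) := by fun_prop
        filter_upwards [hc.continuousAt.eventually_ne (sub_ne_zero.2 hMt)] with u hu hu'
        exact absurd (sub_eq_zero.2 hu') hu
    have heq : φ =ᶠ[nhds t] fun u => L (a + u • (b - a)) := by
      filter_upwards [hloc] with u hu
      obtain ⟨M, hM, hMu⟩ := h (a + u • (b - a))
      exact hu M hM hMu
    refine HasDerivAt.congr_of_eventuallyEq ?_ heq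
    have h1 : HasDerivAt (fun u : ℝ => a + u • (b - a)) (b - a) t := by
      simpa using ((hasDerivAt_id t).smul_const (b - a)).const_add a
    exact L.hasFDerivAt.comp_hasDerivAt t h1
  have hbound : ∀ t, t ∉ Z → ‖deriv φ t‖ ≤ C * ‖b - a‖ := by
    intro t ht
    obtain ⟨L, hL, hd⟩ := hderiv t ht
    rw [hd.deriv]
    exact L.le_of_opNorm_le (hC L hL) _
  have hae : ∀ᵐ t : ℝ, ‖deriv φ t‖ ≤ C * ‖b - a‖ := by
    filter_upwards [hZc.ae_notMem volume] with t ht using hbound t ht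
  have hint : IntervalIntegrable (deriv φ) volume 0 1 := by
    refine (intervalIntegrable_const (c := C * ‖b - a‖)).mono_fun
      (measurable_deriv φ).aestronglyMeasurable ?_
    filter_upwards [ae_restrict_of_ae hae] with t ht
    exact ht.trans (le_abs_self _)
  have hftc := integral_eq_of_hasDerivAt_off_countable φ (deriv φ) (a := 0) (b := 1) hZc
    hφc.continuousOn (fun t ht => by
      obtain ⟨L, -, hd⟩ := hderiv t ht.2
      rw [hd.deriv]; exact hd) hint
  have h1 := intervalIntegral.norm_integral_le_of_norm_le_const_ae (a := 0) (b := 1)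
    (hae.mono fun t ht _ => ht)
  rw [hftc] at h1
  simpa [hφ, dist_eq_norm] using h1

theorem memLp_of_lipschitzWith {ι : Type*} [Fintype ι] {γ : ι → Measure ℝ}
    [∀ i, IsProbabilityMeasure (γ i)] (hγ : ∀ i, MemLp id 2 (γ i)) {g : (ι → ℝ) → ℝ} {K : ℝ≥0}
    (hg : LipschitzWith K g) : MemLp g 2 (Measure.pi γ) := by
  have h1 : ∀ i, MemLp (fun y : ι → ℝ => y i) 2 (Measure.pi γ) := fun i =>
    (hγ i).comp_measurePreserving (measurePreserving_eval γ i)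
  have hsum : MemLp (fun y : ι → ℝ => ∑ i, |y i|) 2 (Measure.pi γ) :=
    memLp_finsetSum Finset.univ fun i _ => (h1 i).abs
  have h2 : MemLp (fun y : ι → ℝ => |g 0| + K * ∑ i, |y i|) 2 (Measure.pi γ) :=
    (memLp_const |g 0|).add (hsum.const_mul (K : ℝ))
  refine h2.mono' hg.continuous.aestronglyMeasurable (Filter.Eventually.of_forall fun y => ?_)
  have h3 := hg.dist_le_mul y 0
  rw [Real.dist_eq, dist_zero_right] at h3
  have h4 : ‖y‖ ≤ ∑ i, |y i| :=
    (pi_norm_le_iff_of_nonneg (Finset.sum_nonneg fun i _ => abs_nonneg _)).2 fun i =>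
      Finset.single_le_sum (f := fun i => |y i|) (fun i _ => abs_nonneg _) (Finset.mem_univ i)
  have h5 : |g y| ≤ |g 0| + |g y - g 0| := by
    have := abs_add_le (g 0) (g y - g 0); rwa [add_sub_cancel] at this
  rw [Real.norm_eq_abs]
  have h6 : (K : ℝ) * ‖y‖ ≤ K * ∑ i, |y i| := by gcongr
  linarith

theorem integrable_gaussianReal_iff {m : ℝ} {v : ℝ≥0} (hv : v ≠ 0) {f : ℝ → ℝ} :
    Integrable f (gaussianReal m v) ↔ Integrable fun t => gaussianPDFReal m v t * f t := by
  rw [gaussianReal_of_var_ne_zero m hv, integrable_withDensity_iff_integrable_smul'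
    (measurable_gaussianPDF m v) (Filter.Eventually.of_forall fun _ => gaussianPDF_lt_top)]
  simp [toReal_gaussianPDF]

theorem hasDerivAt_gaussianPDFReal (m : ℝ) (v : ℝ≥0) (t : ℝ) :
    HasDerivAt (gaussianPDFReal m v) (-((t - m) / v) * gaussianPDFReal m v t) t := by
  have h1 : HasDerivAt (fun x : ℝ => -(x - m) ^ 2 / (2 * v)) (-((t - m) / v)) t := by
    refine (((((hasDerivAt_id' t).sub_const m).fun_pow 2).fun_neg).div_const
      (2 * (v : ℝ))).congr_deriv ?_
    simp only [Nat.cast_ofNat, Nat.add_one_sub_one, pow_one, mul_one]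
    rw [neg_div, mul_div_mul_left _ _ two_ne_zero]
  refine (h1.exp.const_mul (√(2 * Real.pi * v))⁻¹).congr_deriv ?_
  rw [gaussianPDFReal]
  ring

theorem memLp_of_lipschitzWith_gaussianReal {m : ℝ} {v : ℝ≥0} {f : ℝ → ℝ} {K : ℝ≥0}
    (hf : LipschitzWith K f) : MemLp f 2 (gaussianReal m v) := by
  have h2 : MemLp (fun t : ℝ => |f 0| + K * |t|) 2 (gaussianReal m v) :=
    (memLp_const |f 0|).add ((memLp_id_gaussianReal' 2 (by simp)).abs.const_mul (K : ℝ))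
  refine h2.mono' hf.continuous.aestronglyMeasurable (Filter.Eventually.of_forall fun t => ?_)
  have h3 := hf.dist_le_mul t 0
  rw [Real.dist_eq, Real.dist_eq, sub_zero] at h3
  have h5 : |f t| ≤ |f 0| + |f t - f 0| := by
    have := abs_add_le (f 0) (f t - f 0); rwa [add_sub_cancel] at this
  rw [Real.norm_eq_abs]
  linarith

theorem tendsto_mul_gaussianPDFReal {m : ℝ} {v : ℝ≥0} (hv : v ≠ 0) {f : ℝ → ℝ} {K : ℝ≥0}
    (hf : LipschitzWith K f) :
    Filter.Tendsto (fun t => f t * gaussianPDFReal m v t) (Filter.cocompact ℝ) (nhds 0) := by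
  have hv0 : (0 : ℝ) < v := by positivity
  have ha : 0 < (2 * (v : ℝ))⁻¹ := by positivity
  have ht : Filter.Tendsto (fun t : ℝ => t - m) (Filter.cocompact ℝ) (Filter.cocompact ℝ) :=
    (Homeomorph.subRight m).isClosedEmbedding.tendsto_cocompact
  set c := (√(2 * Real.pi * v))⁻¹ with hc
  have hc0 : 0 ≤ c := by positivity
  have h := ((((tendsto_rpow_abs_mul_exp_neg_mul_sq_cocompact ha 0).comp ht).const_mul |f m|).add
    (((tendsto_rpow_abs_mul_exp_neg_mul_sq_cocompact ha 1).comp ht).const_mul (K : ℝ))).const_mul c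
  simp only [mul_zero, add_zero] at h
  refine squeeze_zero_norm (fun t => ?_) h
  have h3 := hf.dist_le_mul t m
  rw [Real.dist_eq, Real.dist_eq] at h3
  have h5 : |f t| ≤ |f m| + K * |t - m| := by
    have := abs_add_le (f m) (f t - f m); rw [add_sub_cancel] at this; linarith
  simp only [Function.comp_def, Real.rpow_zero, Real.rpow_one, one_mul]
  rw [norm_mul, Real.norm_eq_abs, Real.norm_eq_abs,
    abs_of_nonneg (gaussianPDFReal_nonneg m v t), gaussianPDFReal, ← hc]
  have h6 : -(t - m) ^ 2 / (2 * (v : ℝ)) = -(2 * (v : ℝ))⁻¹ * (t - m) ^ 2 := by ring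
  rw [h6]
  calc |f t| * (c * Real.exp (-(2 * (v : ℝ))⁻¹ * (t - m) ^ 2))
      ≤ (|f m| + K * |t - m|) * (c * Real.exp (-(2 * (v : ℝ))⁻¹ * (t - m) ^ 2)) := by gcongr
    _ = _ := by ring

/-- Stein's identity for Lipschitz functions of a real Gaussian variable. -/
theorem integral_gaussianReal_stein {m : ℝ} {v : ℝ≥0} (hv : v ≠ 0) {f : ℝ → ℝ} {K : ℝ≥0}
    (hf : LipschitzWith K f) :
    ∫ t, (f t * (t - m) - v * deriv f t) ∂gaussianReal m v = 0 := by
  have hv0 : (v : ℝ) ≠ 0 := by positivity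
  have hint : Integrable (fun t => f t * (t - m) - v * deriv f t) (gaussianReal m v) := by
    refine Integrable.sub ?_ (Integrable.const_mul ?_ _)
    · exact (memLp_of_lipschitzWith_gaussianReal hf).integrable_mul
        ((memLp_id_gaussianReal' 2 (by simp)).sub (memLp_const m))
    · exact (integrable_const (K : ℝ)).mono' (measurable_deriv f).aestronglyMeasurable
        (Filter.Eventually.of_forall fun t => norm_deriv_le_of_lipschitz hf)
  have hint' := (integrable_gaussianReal_iff hv).1 hint
  rw [integral_gaussianReal_eq_integral_smul hv]
  simp only [smul_eq_mul]
  have hd : ∀ t, deriv (gaussianPDFReal m v) t = -((t - m) / v) * gaussianPDFReal m v t :=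
    fun t => (hasDerivAt_gaussianPDFReal m v t).deriv
  have hsmooth : ContDiff ℝ 1 (gaussianPDFReal m v) := by
    rw [gaussianPDFReal_def]
    fun_prop
  have hparts : ∀ R : ℝ, ∫ t in -R..R, gaussianPDFReal m v t * (f t * (t - m) - v * deriv f t) =
      -v * (f R * gaussianPDFReal m v R - f (-R) * gaussianPDFReal m v (-R)) := by
    intro R
    rw [← AbsolutelyContinuousOnInterval.integral_deriv_mul_eq_sub
      hf.lipschitzOnWith.absolutelyContinuousOnInterval
      hsmooth.contDiffOn.absolutelyContinuousOnInterval, ← intervalIntegral.integral_const_mul]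
    refine intervalIntegral.integral_congr fun t _ => ?_
    simp only [hd]
    field_simp
    ring
  have hlim := intervalIntegral_tendsto_integral hint' Filter.tendsto_neg_atTop_atBot
    Filter.tendsto_id
  simp only [id, hparts] at hlim
  have h0 := tendsto_mul_gaussianPDFReal (m := m) hv hf
  rw [cocompact_eq_atBot_atTop, Filter.tendsto_sup] at h0
  have h1 := (h0.2.sub (h0.1.comp Filter.tendsto_neg_atTop_atBot)).const_mul (-(v : ℝ))
  simp only [sub_zero, mul_zero] at h1
  exact tendsto_nhds_unique hlim h1

section pi

variable {ι : Type*} [Fintype ι] [DecidableEq ι] (γ : ι → Measure ℝ)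
  [∀ i, IsProbabilityMeasure (γ i)]

omit [Fintype ι] in
theorem measurable_update_prod (i : ι) :
    Measurable fun q : (ι → ℝ) × ℝ => Function.update q.1 i q.2 := by
  refine measurable_pi_lambda _ fun j => ?_
  by_cases h : j = i
  · subst h; simpa using measurable_snd
  · simp only [Function.update_of_ne h]
    exact (measurable_pi_apply j).comp measurable_fst

theorem measurePreserving_update (i : ι) :
    MeasurePreserving (fun q : (ι → ℝ) × ℝ => Function.update q.1 i q.2)
      ((Measure.pi γ).prod (γ i)) (Measure.pi γ) := by
  refine ⟨measurable_update_prod i, (Measure.pi_eq fun s hs => ?_).symm⟩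
  rw [Measure.map_apply (measurable_update_prod i) (MeasurableSet.univ_pi hs)]
  have : (fun q : (ι → ℝ) × ℝ => Function.update q.1 i q.2) ⁻¹' Set.univ.pi s =
      (Set.univ.pi (Function.update s i Set.univ)) ×ˢ s i := by
    ext q
    simp only [Set.mem_preimage, Set.mem_univ_pi, Set.mem_prod]
    constructor
    · intro h
      refine ⟨fun j => ?_, by simpa using h i⟩
      by_cases hj : j = i
      · subst hj; simp
      · simpa [hj] using h j
    · rintro ⟨h1, h2⟩ j
      by_cases hj : j = i
      · subst hj; simpa using h2
      · simpa [hj] using h1 j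
  rw [this, Measure.prod_prod, Measure.pi_pi, ← Finset.mul_prod_erase _ _ (Finset.mem_univ i),
    ← Finset.mul_prod_erase _ (fun j => γ j (s j)) (Finset.mem_univ i)]
  simp only [Function.update_self, measure_univ, one_mul]
  rw [mul_comm]
  congr 1
  refine Finset.prod_congr rfl fun j hj => ?_
  rw [Function.update_of_ne (Finset.ne_of_mem_erase hj)]

theorem ae_dotProduct_ne_zero [∀ i, NullSingletonClass (γ i)] {a : ι → ℝ} (ha : a ≠ 0) :
    ∀ᵐ y ∂Measure.pi γ, a ⬝ᵥ y ≠ 0 := by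
  obtain ⟨i, hi⟩ := Function.ne_iff.1 ha
  have hmeas : MeasurableSet {y : ι → ℝ | a ⬝ᵥ y = 0} :=
    measurableSet_eq_fun (by unfold dotProduct; fun_prop) measurable_const
  rw [ae_iff]
  simp only [not_not]
  rw [← (measurePreserving_update γ i).measure_preimage hmeas.nullMeasurableSet,
    Measure.measure_prod_null (measurable_update_prod i hmeas)]
  refine Filter.Eventually.of_forall fun y => Set.Subsingleton.measure_zero ?_ _
  intro t ht u hu
  have h1 : a ⬝ᵥ Function.update y i t = 0 := ht
  have h2 : a ⬝ᵥ Function.update y i u = 0 := hu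
  have h3 : a ⬝ᵥ (Function.update y i t - Function.update y i u) = 0 := by
    rw [dotProduct_sub, h1, h2, sub_zero]
  have h4 : Function.update y i t - Function.update y i u = Pi.single i (t - u) := by
    ext j
    by_cases hj : j = i
    · subst hj; simp
    · simp [hj]
  rw [h4, dotProduct_single] at h3
  exact sub_eq_zero.1 ((mul_eq_zero.1 h3).resolve_left hi)

end pi

instance isProbabilityMeasure_normalLaw (μ : Fin n → ℝ) (v : ℝ≥0) :
    IsProbabilityMeasure (normalLaw μ v) := by
  unfold normalLaw; infer_instance

theorem lipschitzWith_update {ι : Type*} [Fintype ι] [DecidableEq ι] (y : ι → ℝ) (i : ι) :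
    LipschitzWith 1 (fun t : ℝ => Function.update y i t) := by
  refine LipschitzWith.of_dist_le_mul fun t u => ?_
  rw [NNReal.coe_one, one_mul, dist_pi_le_iff dist_nonneg]
  intro j
  by_cases hj : j = i
  · subst hj; simp
  · simp [hj]

/-- The partial derivative in direction `i`. -/
def partialDeriv (g : (Fin n → ℝ) → ℝ) (i : Fin n) (y : Fin n → ℝ) : ℝ :=
  deriv (fun t => g (Function.update y i t)) (y i)

theorem measurable_partialDeriv {g : (Fin n → ℝ) → ℝ} (hg : Continuous g) (i : Fin n) :
    Measurable (partialDeriv g i) := by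
  have h : Continuous (Function.uncurry fun (y : Fin n → ℝ) (t : ℝ) =>
      g (Function.update y i t)) :=
    hg.comp (continuous_fst.update i continuous_snd)
  exact (measurable_deriv_with_param h).comp (measurable_id.prodMk (measurable_pi_apply i))

section stein

variable {μ : Fin n → ℝ} {v : ℝ≥0} {g : (Fin n → ℝ) → ℝ} {K : ℝ≥0} (hg : LipschitzWith K g)
include hg

theorem abs_partialDeriv_le (i : Fin n) (y : Fin n → ℝ) : ‖partialDeriv g i y‖ ≤ K := by
  have h : LipschitzWith (K * 1) fun t => g (Function.update y i t) :=
    hg.comp (lipschitzWith_update y i)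
  rw [mul_one] at h
  exact norm_deriv_le_of_lipschitz h

theorem integrable_partialDeriv (i : Fin n) : Integrable (partialDeriv g i) (normalLaw μ v) :=
  (integrable_const (K : ℝ)).mono' (measurable_partialDeriv hg.continuous i).aestronglyMeasurable
    (Filter.Eventually.of_forall (abs_partialDeriv_le hg i))

theorem memLp_normalLaw_of_lipschitzWith : MemLp g 2 (normalLaw μ v) :=
  memLp_of_lipschitzWith (fun i => memLp_id_gaussianReal' 2 (by simp)) hg

omit hg in
theorem memLp_eval_normalLaw (i : Fin n) : MemLp (fun y : Fin n → ℝ => y i) 2 (normalLaw μ v) :=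
  memLp_normalLaw_of_lipschitzWith (LipschitzWith.eval i)

omit hg in
theorem integral_eval_normalLaw (i : Fin n) : ∫ y, y i ∂normalLaw μ v = μ i := by
  have h := (measurePreserving_eval (fun i => gaussianReal (μ i) v) i)
  have h1 := integral_map (μ := normalLaw μ v) (f := fun t : ℝ => t)
    h.measurable.aemeasurable (by fun_prop)
  rw [normalLaw, h.map_eq, integral_id_gaussianReal] at h1
  exact h1.symm

theorem integral_normalLaw_stein (hv : v ≠ 0) (i : Fin n) :
    ∫ y, g y * (y i - μ i) ∂normalLaw μ v = v * ∫ y, partialDeriv g i y ∂normalLaw μ v := by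
  have hi1 : Integrable (fun y => g y * (y i - μ i)) (normalLaw μ v) :=
    (memLp_normalLaw_of_lipschitzWith hg).integrable_mul
      ((memLp_eval_normalLaw i).sub (memLp_const (μ i)))
  have hi2 := (integrable_partialDeriv (μ := μ) (v := v) hg i).const_mul (v : ℝ)
  rw [← integral_const_mul, ← sub_eq_zero, ← integral_sub hi1 hi2]
  have hi := hi1.sub hi2
  have hmp := measurePreserving_update (fun i => gaussianReal (μ i) v) i
  have hcomp : Integrable (fun q : (Fin n → ℝ) × ℝ => g (Function.update q.1 i q.2) *
      (Function.update q.1 i q.2 i - μ i) - v * partialDeriv g i (Function.update q.1 i q.2))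
      ((Measure.pi fun i => gaussianReal (μ i) v).prod (gaussianReal (μ i) v)) :=
    hmp.integrable_comp_of_integrable hi
  rw [normalLaw, ← hmp.map_eq, integral_map hmp.measurable.aemeasurable
    (by rw [hmp.map_eq]; exact hi.aestronglyMeasurable),
    integral_prod _ hcomp]
  refine integral_eq_zero_of_ae (Filter.Eventually.of_forall fun y => ?_)
  have hl : LipschitzWith (K * 1) fun t => g (Function.update y i t) :=
    hg.comp (lipschitzWith_update y i)
  have h := integral_gaussianReal_stein (m := μ i) hv hl
  simpa [partialDeriv] using h

theorem covariance_normalLaw (hv : v ≠ 0) (i : Fin n) :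
    cov[g, fun y => y i; normalLaw μ v] = v * ∫ y, partialDeriv g i y ∂normalLaw μ v := by
  have h1 := memLp_normalLaw_of_lipschitzWith (μ := μ) (v := v) hg
  have h2 := memLp_eval_normalLaw (μ := μ) (v := v) i
  have hi1 : Integrable (fun y => g y * y i) (normalLaw μ v) := h1.integrable_mul h2
  have hi2 : Integrable (fun y => g y * μ i) (normalLaw μ v) :=
    (h1.integrable (by norm_num)).mul_const _
  rw [covariance_eq_sub h1 h2, integral_eval_normalLaw, ← integral_normalLaw_stein hg hv,
    ← integral_mul_const]
  simp only [Pi.mul_apply, mul_sub]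
  rw [integral_sub hi1 hi2]

end stein

theorem ae_dotProduct_normalLaw {v : ℝ≥0} (hv : v ≠ 0) (μ : Fin n → ℝ) {a : Fin n → ℝ}
    (ha : a ≠ 0) : ∀ᵐ y ∂normalLaw μ v, a ⬝ᵥ y ≠ 0 := by
  have := fun i => nullSingletonClass_gaussianReal (μ := μ i) hv
  exact ae_dotProduct_ne_zero _ ha

theorem ae_generic (X : Matrix (Fin n) (Fin p) ℝ) (μ : Fin n → ℝ) {v : ℝ≥0} (hv : v ≠ 0) :
    ∀ᵐ y ∂normalLaw μ v, Generic X y :=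
  (Finset.eventually_all _).2 fun _ ha =>
    ae_dotProduct_normalLaw hv μ (by simp only [normals, Finset.mem_filter] at ha; exact ha.2)

theorem isOpenPosMeasure_normalLaw (μ : Fin n → ℝ) {v : ℝ≥0} (hv : v ≠ 0) :
    (normalLaw μ v).IsOpenPosMeasure := by
  have := fun i => (gaussianReal_absolutelyContinuous' (μ i) hv).isOpenPosMeasure
  unfold normalLaw
  infer_instance

theorem dense_generic (X : Matrix (Fin n) (Fin p) ℝ) : Dense {y | Generic X y} := by
  have := isOpenPosMeasure_normalLaw (0 : Fin n → ℝ) one_ne_zero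
  exact Measure.dense_of_ae (ae_generic X 0 one_ne_zero)

theorem exists_selection_of_dense {g : (Fin n → ℝ) → Fin n → ℝ} (hg : Continuous g)
    {F : Set (Matrix (Fin n) (Fin n) ℝ)} (hF : F.Finite) {D : Set (Fin n → ℝ)} (hD : Dense D)
    (h : ∀ y ∈ D, ∃ S ∈ F, g y = S *ᵥ y) (y : Fin n → ℝ) : ∃ S ∈ F, g y = S *ᵥ y := by
  have hcl : IsClosed (⋃ S ∈ F, {y | g y = S *ᵥ y}) :=
    hF.isClosed_biUnion fun S _ =>
      isClosed_eq hg (continuous_const.matrix_mulVec continuous_id)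
  have hsub : D ⊆ ⋃ S ∈ F, {y | g y = S *ᵥ y} := fun y hy => by simpa using h y hy
  have := hcl.closure_subset_iff.2 hsub (hD y)
  simpa using this

theorem ae_mulVec_ne {v : ℝ≥0} (hv : v ≠ 0) (μ : Fin n → ℝ)
    {F : Set (Matrix (Fin n) (Fin n) ℝ)} (hF : F.Finite) :
    ∀ᵐ y ∂normalLaw μ v, ∀ S ∈ F, ∀ T ∈ F, S *ᵥ y = T *ᵥ y → S = T := by
  rw [ae_ball_iff hF.countable]
  intro S _
  rw [ae_ball_iff hF.countable]
  intro T _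
  by_cases hST : S = T
  · exact Filter.Eventually.of_forall fun _ _ => hST
  obtain ⟨i, hi⟩ := Function.ne_iff.1 hST
  filter_upwards [ae_dotProduct_normalLaw hv μ (sub_ne_zero.2 hi)] with y hy h
  refine absurd ?_ hy
  have := congrFun h i
  rw [sub_dotProduct]
  exact sub_eq_zero.2 this

theorem exists_partialDeriv_eq {g : (Fin n → ℝ) → Fin n → ℝ} (hg : Continuous g)
    {F : Set (Matrix (Fin n) (Fin n) ℝ)} (hF : F.Finite) (h : ∀ y, ∃ S ∈ F, g y = S *ᵥ y)
    {y : Fin n → ℝ} (hy : ∀ S ∈ F, ∀ T ∈ F, S *ᵥ y = T *ᵥ y → S = T) :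
    ∃ S ∈ F, ∀ i, partialDeriv (fun y => g y i) i y = S i i := by
  obtain ⟨S, hS, hSy⟩ := h y
  refine ⟨S, hS, fun i => ?_⟩
  have hloc : ∀ᶠ z in nhds y, g z = S *ᵥ z := by
    have h1 : ∀ᶠ z in nhds y, ∀ T ∈ F, g z = T *ᵥ z → T = S := by
      rw [Filter.eventually_all_finite hF]
      intro T hT
      by_cases hTy : g y = T *ᵥ y
      · exact Filter.Eventually.of_forall fun z _ => hy T hT S hS (hTy.symm.trans hSy)
      · have hc : Continuous fun z => g z - T *ᵥ z :=
          hg.sub (continuous_const.matrix_mulVec continuous_id)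
        filter_upwards [hc.continuousAt.eventually_ne (sub_ne_zero.2 hTy)] with z hz hz'
        exact absurd (sub_eq_zero.2 hz') hz
    filter_upwards [h1] with z hz
    obtain ⟨T, hT, hTz⟩ := h z
    rw [← hz T hT hTz, hTz]
  have hcu : ContinuousAt (fun t : ℝ => Function.update y i t) (y i) :=
    (continuous_const.update i continuous_id).continuousAt
  have hloc' : ∀ᶠ t in nhds (y i), g (Function.update y i t) = S *ᵥ Function.update y i t :=
    hcu.eventually (p := fun z => g z = S *ᵥ z) (by simpa only [Function.update_eq_self] using hloc)
  have heq : (fun t => g (Function.update y i t) i) =ᶠ[nhds (y i)]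
      fun t => (S *ᵥ y) i + S i i * (t - y i) := by
    filter_upwards [hloc'] with t ht
    have hu : Function.update y i t = y + Pi.single i (t - y i) := by
      ext j
      by_cases hj : j = i
      · subst hj; simp
      · simp [hj]
    rw [ht, hu, Matrix.mulVec_add, Pi.add_apply]
    congr 1
    change S i ⬝ᵥ Pi.single i (t - y i) = _
    rw [dotProduct_single]
  rw [partialDeriv, heq.deriv_eq]
  have : HasDerivAt (fun t => (S *ᵥ y) i + S i i * (t - y i)) (S i i * 1) (y i) :=
    (((hasDerivAt_id' (y i)).sub_const (y i)).const_mul (S i i)).const_add _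
  rw [this.deriv, mul_one]

theorem df_of_selection {g : (Fin n → ℝ) → Fin n → ℝ} (hg : Continuous g)
    {F : Set (Matrix (Fin n) (Fin n) ℝ)} (hF : F.Finite) (h : ∀ y, ∃ S ∈ F, g y = S *ᵥ y)
    {k : ℝ} (hk : ∀ S ∈ F, S.trace = k) (μ : Fin n → ℝ) {v : ℝ≥0} (hv : v ≠ 0) :
    (∀ i, MemLp (fun y => g y i) 2 (normalLaw μ v)) ∧ df μ v g = k := by
  have hlip : ∀ i, ∃ K : ℝ≥0, LipschitzWith K fun y => g y i := by
    intro i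
    refine exists_lipschitzWith_of_selection (continuous_pi_iff.1 hg i)
      (hF.image fun S => LinearMap.toContinuousLinearMap
        ((LinearMap.proj (R := ℝ) (φ := fun _ : Fin n => ℝ) i).comp S.mulVecLin)) fun y => ?_
    obtain ⟨S, hS, hSy⟩ := h y
    exact ⟨_, ⟨S, hS, rfl⟩, congrFun hSy i⟩
  choose K hK using hlip
  refine ⟨fun i => memLp_normalLaw_of_lipschitzWith (hK i), ?_⟩
  have hv0 : (v : ℝ) ≠ 0 := by positivity
  have h1 : df μ v g = ∑ i, ∫ y, partialDeriv (fun y => g y i) i y ∂normalLaw μ v := by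
    refine Finset.sum_congr rfl fun i _ => ?_
    rw [covariance_normalLaw (hK i) hv, mul_div_cancel_left₀ _ hv0]
  rw [h1, ← integral_finsetSum _ fun i _ => integrable_partialDeriv (hK i) i]
  have h2 : ∀ᵐ y ∂normalLaw μ v, ∑ i, partialDeriv (fun y => g y i) i y = k := by
    filter_upwards [ae_mulVec_ne hv μ hF] with y hy
    obtain ⟨S, hS, hSd⟩ := exists_partialDeriv_eq hg hF h hy
    rw [← hk S hS]
    exact Finset.sum_congr rfl fun i _ => hSd i
  rw [integral_congr_ae h2]
  simp

theorem df_congr_ae {μ : Fin n → ℝ} {v : ℝ≥0} {f g : (Fin n → ℝ) → Fin n → ℝ}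
    (h : f =ᵐ[normalLaw μ v] g) : df μ v f = df μ v g := by
  refine Finset.sum_congr rfl fun i _ => ?_
  congr 1
  have hi : (fun y => f y i) =ᵐ[normalLaw μ v] fun y => g y i :=
    h.mono fun y hy => congrFun hy i
  rw [covariance, covariance, integral_congr_ae hi]
  refine integral_congr_ae (hi.mono fun y hy => ?_)
  simp only [hy]

theorem memLp_lastFit_and_df {X : Matrix (Fin n) (Fin p) ℝ} (hX : LinearIndependent ℝ X.col)
    (hpc : PositiveCone X) (μ : Fin n → ℝ) {v : ℝ≥0} (hv : v ≠ 0) {k : ℕ} (hk : k ≤ p) :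
    (∀ i, MemLp (fun y => lastFit X k y i) 2 (normalLaw μ v)) ∧ df μ v (lastFit X k) = k := by
  have hae : lastFit X k =ᵐ[normalLaw μ v] fun y => fit X y (kthKnot X k y) := by
    filter_upwards [ae_generic X μ hv] with y hy
    rw [lastFit, knot_lastStep hX hpc (hy.stepsWith_nonempty hX hk)]
  have hcont := continuous_fit_kthKnot hX hpc k
  have hsel := exists_selection_of_dense hcont (finite_selectors X k) (dense_generic X)
    fun y hy => Generic.exists_fit_kthKnot_eq hX hpc hy hk
  obtain ⟨h1, h2⟩ := df_of_selection hcont (finite_selectors X k) hsel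
    (fun S hS => trace_of_mem_selectors hX hS) μ hv
  exact ⟨fun i => (memLp_congr_ae (hae.mono fun y hy => congrFun hy i)).2 (h1 i),
    (df_congr_ae hae).trans h2⟩

end Lasso

end

theorem mainTheorem4 {n p : ℕ} (X : Matrix (Fin n) (Fin p) ℝ)
    (hX : LinearIndependent ℝ X.col) :
    -- the lasso path and its transition points are well defined
    ((∀ (y : Fin n → ℝ) (l : ℝ), 0 ≤ l →
        ∃! β, ∀ b, Lasso.objective X y l β ≤ Lasso.objective X y l b) ∧
      ∀ y : Fin n → ℝ,
        (Lasso.transitionPoints X y).Finite ∧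
        (∀ l, Lasso.knot X y 0 < l → Lasso.coef X y l = 0) ∧
        ∀ m < Lasso.lastIndex X y,
          ∀ l ∈ Set.Ioo (Lasso.knot X y (m + 1)) (Lasso.knot X y m),
            Lasso.active X y l = Lasso.intervalActive X y m ∧
            Lasso.sgn X y l = Lasso.intervalSgn X y m) ∧
    -- one at a time, outside finitely many hyperplanes
    (∃ M : Finset (Fin n → ℝ), (∀ a ∈ M, a ≠ 0) ∧
      ∀ y : Fin n → ℝ, (∀ a ∈ M, a ⬝ᵥ y ≠ 0) →
        ∀ m ≤ Lasso.lastIndex X y,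
          (Lasso.joining X y m).card ≤ 1 ∧ (Lasso.leaving X y m).card ≤ 1 ∧
          ∀ i ∈ Lasso.joining X y m, Lasso.stepDenom X y m i ≠ 0) ∧
    -- the fit at a transition point, and the trace
    (∀ (y : Fin n → ℝ) (m : ℕ), m ≤ Lasso.lastIndex X y → 0 < Lasso.knot X y m →
      ∀ i ∈ Lasso.joining X y m,
        (Lasso.stepDenom X y m i ≠ 0 →
          Lasso.fit X y (Lasso.knot X y m) = Lasso.stepMatrix X y m i *ᵥ y) ∧
        (Lasso.stepMatrix X y m i).trace = ((Lasso.active X y (Lasso.knot X y m)).card : ℝ)) ∧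
    -- the last step with `k` nonzero predictors exists almost surely
    (∀ (μ : Fin n → ℝ) (v : ℝ≥0), 0 < v → ∀ k ≤ p,
      ∀ᵐ y ∂(Lasso.normalLaw μ v), (Lasso.stepsWith X y k).Nonempty) ∧
    -- the degrees of freedom under the positive cone condition
    (Lasso.PositiveCone X →
      ∀ (μ : Fin n → ℝ) (v : ℝ≥0), 0 < v → ∀ k ≤ p,
        (∀ i, MemLp (fun y => Lasso.lastFit X k y i) 2 (Lasso.normalLaw μ v)) ∧
        Lasso.df μ v (Lasso.lastFit X k) = (k : ℝ)) := by
  refine ⟨⟨fun y l hl => Lasso.existsUnique_minimizer X hX y hl, fun y =>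
    ⟨Lasso.finite_transitionPoints hX y, fun l hl => Lasso.coef_eq_zero_of_knot_zero_lt hX y hl,
      fun m hm l hl => ⟨Lasso.active_eq_intervalActive hX y hm hl,
        Lasso.sgn_eq_intervalSgn hX y hm hl⟩⟩⟩, ?_, ?_, ?_, ?_⟩
  · refine ⟨Lasso.normals X, fun a ha => ?_, fun y hy m hm => ?_⟩
    · simp only [Lasso.normals, Finset.mem_filter] at ha
      exact ha.2
    · have hy : Lasso.Generic X y := hy
      exact ⟨hy.card_joining_le hX hm, hy.card_leaving_le hX hm,
        fun i hi => hy.stepDenom_ne_zero hX hm hi⟩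
  · intro y m hm _ i hi
    rw [Lasso.stepDenom_eq, Lasso.stepMatrix_eq]
    exact ⟨Lasso.fit_eq_selector hX y (Lasso.knot_nonneg hX y)
      (Lasso.corr_of_mem_joining hX hm hi), Lasso.trace_selector hX _ _ _ i⟩
  · intro μ v hv k hk
    filter_upwards [Lasso.ae_generic X μ hv.ne'] with y hy
    exact hy.stepsWith_nonempty hX hk
  · intro hpc μ v hv k hk
    exact Lasso.memLp_lastFit_and_df hX hpc μ hv.ne' hk
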